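/- **Setting.** Graphs are finite, simple, undirected and connected; $n$ denotes the number of nodes. For a constant $\Delta$, let $\mathcal F_\Delta$ be the family of all such graphs of maximum degree at most $\Delta$ (no other restriction is placed on the graphs). *LCL problems.* A locally checkable labelling (LCL) problem is a tuple $\Pi=(\Sigma_{\mathsf{in}},\Sigma_{\mathsf{out}},C,r)$, where $\Sigma_{\mathsf{in}},\Sigma_{\mathsf{out}}$ are finite sets of labels, $r\in\mathbb N$, and $C$ is a set of (isomorphism types of) finite graphs $H$, each with a centre at distance at most $r$ from all nodes of $H$ and with every node labelled by a pair from $\Sigma_{\mathsf{in}}\times\Sigma_{\mathsf{out}}$. Given $G=(V,E)$ and an input $i\colon V\to\Sigma_{\mathsf{in}}$, an output $o\colon V\to\Sigma_{\mathsf{out}}$ is valid if for every $v\in V$ the subgraph of $G$ induced by the nodes at distance at most $r$ from $v$, centred at $v$ and labelled with $(i,o)$, belongs to $C$. *Deterministic LOCAL algorithms.* The nodes of $G$ carry distinct identifiers from $\{1,\dots,n^c\}$ for a constant $c\ge 1$, and initially each node knows $n$, its identifier, its degree and its input label. In $t$ rounds a node $v$ learns exactly its $t$-radius neighbourhood: the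 nodes at distance at most $t$ from $v$ with their initial knowledge, and all edges incident to nodes at distance at most $t-1$ from $v$. A deterministic algorithm with running time $t(n)$ is a function, the same for all nodes, that maps the $t(n)$-radius neighbourhood of a node to its output label. The time complexity of $\Pi$ on $\mathcal F_\Delta$ is the pointwise smallest $t\colon\mathbb N\to\mathbb N$ such that some deterministic algorithm with running time $t(n)$ produces a valid output on every $n$-node graph in $\mathcal F_\Delta$, for every $n$, every input labelling and every assignment of identifiers. **Theorem.** For every rational number $0\le\alpha\le 1$ there exist a constant $\Delta$ and an LCL problem $\Pi$ such that, for every constant $c\ge 1$, the deterministic LOCAL time complexity of $\Pi$ on $\mathcal F_\Delta$ with identifiers from $\{1,\dots,n^c\}$ exists and is $\Theta(n^{\alpha})$. -/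

import Mathlib

open Filter Asymptotics

/-! ### Locally checkable labelling problems -/

/-- A finite graph with a distinguished centre and a label from `σ` on every node. -/
structure CenteredGraph (σ : Type) where
  size : ℕ
  graph : SimpleGraph (Fin size)
  center : Fin size
  label : Fin size → σ

/-- A locally checkable labelling problem `(Σ_in, Σ_out, C, r)`. The members of `allowed` (the set
`C`) are read up to isomorphism of centred labelled graphs, see `LCL.IsValid`. -/
structure LCL where
  /-- the finite set of input labels -/
  Input : Type
  /-- the finite set of output labels -/
  Output : Type
  finite_input : Finite Input
  finite_output : Finite Output
  /-- the checkability radius `r` -/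
  radius : ℕ
  /-- the set `C` of correctly labelled neighbourhoods -/
  allowed : Set (CenteredGraph (Input × Output))
  radius_le : ∀ H ∈ allowed, ∀ u, H.graph.edist H.center u ≤ (radius : ℕ∞)

/-- `(G, inp, out)` is a valid configuration: for every node `v`, the subgraph of `G` induced by
the nodes at distance at most `r` from `v`, centred at `v` and labelled with the inputs and outputs,
is isomorphic to a member of `C`. -/
def LCL.IsValid (P : LCL) {V : Type} (G : SimpleGraph V) (inp : V → P.Input)
    (out : V → P.Output) : Prop :=
  ∀ v : V, ∃ H ∈ P.allowed,
    ∃ e : G.induce {u | G.edist v u ≤ (P.radius : ℕ∞)} ≃g H.graph,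
      (e.symm H.center : V) = v ∧ ∀ u, H.label (e u) = (inp u, out u)

/-! ### Deterministic algorithms in the LOCAL model -/

/-- What a node knows after some number of rounds. Nodes are named by their identifiers. -/
structure LocalView (σ : Type) where
  /-- the number of nodes of the whole input graph -/
  size : ℕ
  /-- the identifier of the node itself -/
  center : ℕ
  /-- the identifier, degree and input label of every node in the view -/
  nodes : Set (ℕ × ℕ × σ)
  /-- the edges of the view -/
  edges : Set (Sym2 ℕ)

/-- The degree of a node of a finite graph. -/
noncomputable def nodeDegree {V : Type} (G : SimpleGraph V) (v : V) : ℕ :=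
  (G.neighborSet v).ncard

/-- The `t`-radius neighbourhood of `v`: all nodes at distance at most `t` from `v`, each with the
information that it has initially (identifier, degree, input), and all edges incident to a node at
distance at most `t - 1` from `v`. -/
noncomputable def localView {V σ : Type} (G : SimpleGraph V) (ident : V → ℕ) (inp : V → σ)
    (t : ℕ) (v : V) : LocalView σ where
  size := Nat.card V
  center := ident v
  nodes := {x | ∃ u, G.edist v u ≤ (t : ℕ∞) ∧ x = (ident u, nodeDegree G u, inp u)}
  edges := {e | ∃ u w, G.Adj u w ∧ G.edist v u < (t : ℕ∞) ∧ e = s(ident u, ident w)}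

/-- A deterministic algorithm in the LOCAL model: every node applies the same function to the
neighbourhood that it has gathered. Message sizes and local computation are not restricted. -/
abbrev LocalAlgorithm (σ τ : Type) : Type := LocalView σ → τ

/-- The algorithm `A` solves `P` in `t n` rounds on every connected simple graph with `n` nodes and
maximum degree at most `Δ`, for every `n`, every input labelling, and every assignment of unique
identifiers from `{1, …, n ^ c}`. -/
def LCL.SolvedBy (P : LCL) (Δ c : ℕ) (A : LocalAlgorithm P.Input P.Output) (t : ℕ → ℕ) : Prop :=
  ∀ (V : Type) [Finite V] (G : SimpleGraph V), G.Connected → (∀ v, nodeDegree G v ≤ Δ) →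
    ∀ ident : V → ℕ, Function.Injective ident →
      (∀ v, 1 ≤ ident v ∧ ident v ≤ Nat.card V ^ c) →
        ∀ inp : V → P.Input,
          P.IsValid G inp (fun v => A (localView G ident inp (t (Nat.card V)) v))

/-- `t` is the distributed time complexity of `P` on graphs of maximum degree at most `Δ`, with
identifiers from `{1, …, n ^ c}`: the pointwise smallest function such that some algorithm
solves `P` in `t n` rounds. -/
def LCL.HasTimeComplexity (P : LCL) (Δ c : ℕ) (t : ℕ → ℕ) : Prop :=
  IsLeast {s : ℕ → ℕ | ∃ A : LocalAlgorithm P.Input P.Output, P.SolvedBy Δ c A s} t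

/-!
For `α = p / (p + a)` with `p ≥ 1`, the problem `copyLCL p a` asks to copy a bit along a path of
*roots*. A root carries a tree with `a` further levels: every node that is not on the last level
carries a column of cells, which are nodes of the next level. Copies of the tree over consecutive
roots are joined cell by cell, so every column comes with a sequence of columns, one for each root
of the path. The labels of each such sequence have to be the successive states of a counter with
`p` digits, a digit being stored in unary in the cells of the column. All of this is checked
locally (`Good`), and the path may be interrupted at a root whose tree contains an error, provided
that the error is reported by a chain of children that leads to it.

Upper bound: every column independently runs its own counter, so a column with fewer than `h` cells
overflows, and shows an error, within `h ^ p` steps (`Ribbon.exists_next_cell`). Hence a root that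
is followed by `h ^ p` error-free steps has a tree with at least `h ^ a` nodes on the last level
(`card_front_mul_pow_le`), and an error-free path of `2 * h ^ p` roots needs `h ^ (p + a)` nodes
(`pow_le_card_of_path`). If `n < h ^ (p + a)`, then looking back `2 * h ^ p` steps along the path
and `a * h` steps into the trees is enough (`copyOutput_ok`). Paths that close up to cycles are
harmless: without an anchor, the constant bit `false` is consistent.

Lower bound: the graph `hardGraph`, in which all columns have `m` cells and count from `0` to
`m ^ p - 1`, has about `m ^ (p + a)` nodes and no error. A report of an error would have to continue
forever to nodes of larger depth, so the bit of the first root has to reach the last one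
(`hard_bit_eq`), which is at distance `m ^ p - 1` (`pow_le_of_solvedBy`).

The constraint of `copyLCL` and the output of the algorithm are stated for arbitrary labelled
graphs. That they depend only on a ball around a node (`IsLocalFun`) is what turns them into an LCL
problem (`LCL.ofLocal_isValid_iff`) and an algorithm in the LOCAL model
(`LocalAlgorithm.ofFun_localView`). The exponent `0` is realized by `neighbourLCL`.
-/

/-! ### Local functions on labelled graphs -/

/-- The map `φ` matches the radius-`s` surroundings of `u` in the labelled graph `(G, lab)` with
those of `φ u` in `(H, lab')`: labels agree up to distance `s`, and the neighbourhoods of all nodes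
at distance less than `s` correspond. -/
def AgreeUpTo {V W σ : Type} (G : SimpleGraph V) (lab : V → σ) (H : SimpleGraph W) (lab' : W → σ)
    (φ : V → W) : ℕ → V → Prop
  | 0, u => lab' (φ u) = lab u
  | s + 1, u => lab' (φ u) = lab u ∧ (∀ w', H.Adj (φ u) w' ↔ ∃ w, G.Adj u w ∧ φ w = w') ∧
      ∀ w, G.Adj u w → AgreeUpTo G lab H lab' φ s w

section Agree

variable {V W σ : Type} {G : SimpleGraph V} {lab : V → σ} {H : SimpleGraph W} {lab' : W → σ}
  {φ : V → W}

theorem AgreeUpTo.label_eq {s : ℕ} {u : V} (h : AgreeUpTo G lab H lab' φ s u) :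
    lab' (φ u) = lab u := by
  cases s with
  | zero => exact h
  | succ s => exact h.1

theorem AgreeUpTo.adj {s : ℕ} {u w : V} (h : AgreeUpTo G lab H lab' φ (s + 1) u)
    (hw : G.Adj u w) : AgreeUpTo G lab H lab' φ s w := h.2.2 w hw

theorem AgreeUpTo.of_succ {s : ℕ} {u : V} (h : AgreeUpTo G lab H lab' φ (s + 1) u) :
    AgreeUpTo G lab H lab' φ s u := by
  induction s generalizing u with
  | zero => exact h.1
  | succ s ih => exact ⟨h.1, h.2.1, fun w hw => ih (h.2.2 w hw)⟩

theorem AgreeUpTo.mono {s t : ℕ} (hst : s ≤ t) {u : V} (h : AgreeUpTo G lab H lab' φ t u) :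
    AgreeUpTo G lab H lab' φ s u := by
  induction t, hst using Nat.le_induction with
  | base => exact h
  | succ t _ ih => exact ih h.of_succ

theorem AgreeUpTo.comp_label {τ : Type} (g : σ → τ) {s : ℕ} {u : V}
    (h : AgreeUpTo G lab H lab' φ s u) :
    AgreeUpTo G (fun x => g (lab x)) H (fun x => g (lab' x)) φ s u := by
  induction s generalizing u with
  | zero => exact congrArg g h
  | succ s ih => exact ⟨congrArg g h.1, h.2.1, fun w hw => ih (h.2.2 w hw)⟩

/-- A criterion for `AgreeUpTo` in terms of a function `ρ` that behaves like the distance from a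
fixed node. -/
theorem AgreeUpTo.of_rank (ρ : V → ℕ∞) (t : ℕ) (hρ : ∀ u w, G.Adj u w → ρ w ≤ ρ u + 1)
    (hlab : ∀ u, ρ u ≤ t → lab' (φ u) = lab u)
    (hadj : ∀ u, ρ u + 1 ≤ t → ∀ w', H.Adj (φ u) w' ↔ ∃ w, G.Adj u w ∧ φ w = w') :
    ∀ (s : ℕ) (u : V), ρ u + s ≤ t → AgreeUpTo G lab H lab' φ s u
  | 0, u, h => hlab u (by simpa using h)
  | s + 1, u, h => by
    have h1 : ρ u + 1 ≤ t := le_trans (by gcongr; simp) h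
    refine ⟨hlab u (le_trans le_self_add h1), hadj u h1, fun w hw => ?_⟩
    refine AgreeUpTo.of_rank ρ t hρ hlab hadj s w (le_trans ?_ h)
    calc ρ w + s ≤ ρ u + 1 + s := by gcongr; exact hρ u w hw
      _ = ρ u + (s + 1 : ℕ) := by push_cast; ring

end Agree

/-- `F` is determined by the labelled graph up to distance `r` from the node. -/
def IsLocalFun {σ α : Type} (r : ℕ)
    (F : ∀ V : Type, SimpleGraph V → (V → σ) → V → α) : Prop :=
  ∀ (V W : Type) (G : SimpleGraph V) (lab : V → σ) (H : SimpleGraph W) (lab' : W → σ) (φ : V → W),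
    Function.Injective φ → ∀ v, AgreeUpTo G lab H lab' φ r v → F W H lab' (φ v) = F V G lab v

theorem SimpleGraph.edist_le_edist_add_one {V : Type} {G : SimpleGraph V} (v : V) {u w : V}
    (h : G.Adj u w) : G.edist v w ≤ G.edist v u + 1 :=
  G.edist_triangle.trans (by gcongr; exact (SimpleGraph.edist_eq_one_iff_adj.2 h).le)

/-- A shortest path from the centre stays in the ball. -/
theorem SimpleGraph.edist_induce_ball_le {V : Type} (G : SimpleGraph V) (v : V) (r : ℕ)
    (hv : G.edist v v ≤ (r : ℕ∞)) (u : {u | G.edist v u ≤ (r : ℕ∞)}) :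
    (G.induce {u | G.edist v u ≤ (r : ℕ∞)}).edist ⟨v, hv⟩ u ≤ (r : ℕ∞) := by
  obtain ⟨u, hu⟩ := u
  obtain ⟨w, hw⟩ := G.exists_walk_of_edist_ne_top
    (ne_top_of_le_ne_top (ENat.natCast_ne_top r) hu)
  have hsupp : ∀ x ∈ w.support, x ∈ {u | G.edist v u ≤ (r : ℕ∞)} := by
    intro x hx
    classical
    refine le_trans (G.edist_le (w.takeUntil x hx)) (le_trans ?_ hu)
    rw [← hw]
    exact_mod_cast w.length_takeUntil_le_length hx
  refine le_trans (SimpleGraph.edist_le (w.induce _ hsupp)) ?_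
  have : (w.induce _ hsupp).length = w.length := by
    rw [← SimpleGraph.Walk.length_map (SimpleGraph.Embedding.induce _).toHom,
      SimpleGraph.Walk.map_induce]
    rfl
  rw [this, hw]
  exact hu

/-- The LCL problem whose constraint at a node is a local predicate. -/
def LCL.ofLocal (σ τ : Type) [Finite σ] [Finite τ] (r : ℕ)
    (Ok : ∀ V : Type, SimpleGraph V → (V → σ × τ) → V → Prop) : LCL where
  Input := σ
  Output := τ
  finite_input := inferInstance
  finite_output := inferInstance
  radius := r
  allowed := {H | (∀ u, H.graph.edist H.center u ≤ (r : ℕ∞)) ∧ Ok _ H.graph H.label H.center}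
  radius_le := fun _ hH => hH.1

/-- Validity for `LCL.ofLocal` amounts to the local predicate at every node of the graph itself. -/
theorem LCL.ofLocal_isValid_iff {σ τ : Type} [Finite σ] [Finite τ] {r : ℕ}
    {Ok : ∀ V : Type, SimpleGraph V → (V → σ × τ) → V → Prop} (hOk : IsLocalFun r Ok)
    {V : Type} [Finite V] (G : SimpleGraph V) (inp : V → σ) (out : V → τ) :
    (LCL.ofLocal σ τ r Ok).IsValid G inp out ↔ ∀ v, Ok V G (fun u => (inp u, out u)) v := by
  have transfer : ∀ (v : V) (H : CenteredGraph (σ × τ))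
      (e : G.induce {u | G.edist v u ≤ (r : ℕ∞)} ≃g H.graph), (e.symm H.center : V) = v →
      (∀ u, H.label (e u) = (inp u, out u)) →
      (Ok V G (fun u => (inp u, out u)) v = Ok _ H.graph H.label H.center) := by
    intro v H e hc hl
    have hinj : Function.Injective (fun x => (e.symm x : V)) :=
      Subtype.val_injective.comp e.symm.injective
    have := hOk _ V H.graph H.label G (fun u => (inp u, out u)) (fun x => (e.symm x : V)) hinj
      H.center
    rw [hc] at this
    refine this ?_
    refine AgreeUpTo.of_rank (fun x => G.edist v (e.symm x : V)) r ?_ ?_ ?_ r _ ?_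
    · intro u w huw
      exact SimpleGraph.edist_le_edist_add_one v (e.symm.map_adj_iff.2 huw)
    · intro u _
      have := hl (e.symm u)
      rw [e.apply_symm_apply] at this
      exact this.symm
    · intro u hu w'
      constructor
      · intro hw'
        have hw : G.edist v w' ≤ (r : ℕ∞) :=
          (SimpleGraph.edist_le_edist_add_one v hw').trans hu
        refine ⟨e ⟨w', hw⟩, ?_, by simp⟩
        have h2 : (G.induce {u | G.edist v u ≤ (r : ℕ∞)}).Adj (e.symm u) ⟨w', hw⟩ := hw'
        have h3 := e.map_adj_iff.2 h2
        rwa [e.apply_symm_apply] at h3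
      · rintro ⟨w, hw, rfl⟩
        exact e.symm.map_adj_iff.2 hw
    · simp [hc]
  constructor
  · intro h v
    obtain ⟨H, hH, e, hc, hl⟩ := h v
    exact (transfer v H e hc hl).symm ▸ hH.2
  · intro h v
    have hv : G.edist v v ≤ (r : ℕ∞) := by simp
    obtain ⟨k, ⟨f⟩⟩ := Finite.exists_equiv_fin {u | G.edist v u ≤ (r : ℕ∞)}
    let e := SimpleGraph.Iso.map f (G.induce {u | G.edist v u ≤ (r : ℕ∞)})
    let H : CenteredGraph (σ × τ) :=
      { size := k
        graph := (G.induce {u | G.edist v u ≤ (r : ℕ∞)}).map f.toEmbedding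
        center := f ⟨v, hv⟩
        label := fun x => (inp (f.symm x), out (f.symm x)) }
    have hc : (e.symm H.center : V) = v := congrArg Subtype.val (f.symm_apply_apply ⟨v, hv⟩)
    have hl : ∀ u, H.label (e u) = (inp u, out u) := fun u => by
      change (inp (f.symm (f u)), out (f.symm (f u))) = _
      simp
    refine ⟨H, ⟨fun u => ?_, (transfer v H e hc hl) ▸ h v⟩, e, hc, hl⟩
    have h1 := G.edist_induce_ball_le v r hv (e.symm u)
    obtain ⟨w, hw⟩ := SimpleGraph.exists_walk_of_edist_ne_top
      (ne_top_of_le_ne_top (ENat.natCast_ne_top r) h1)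
    rw [← hw] at h1
    have h2 := SimpleGraph.edist_le (w.map e.toHom)
    rw [SimpleGraph.Walk.length_map] at h2
    have h3 : e.toHom (e.symm u) = u := e.apply_symm_apply u
    rw [h3] at h2
    exact h2.trans h1

/-! ### Algorithms in the LOCAL model -/

/-- The input label that a view records for an identifier; an arbitrary label if there is none. -/
noncomputable def LocalView.label {σ : Type} [Nonempty σ] (L : LocalView σ) (i : ℕ) : σ :=
  open Classical in
  if h : ∃ x, ∃ d, (i, d, x) ∈ L.nodes then h.choose else Classical.arbitrary σ

/-- The algorithm that evaluates a function of labelled graphs on the graph formed by the view. The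
function may depend on the number of nodes. -/
noncomputable def LocalAlgorithm.ofFun {σ τ : Type} [Nonempty σ]
    (F : ℕ → ∀ V : Type, SimpleGraph V → (V → σ) → V → τ) : LocalAlgorithm σ τ :=
  fun L => F L.size ℕ (SimpleGraph.fromEdgeSet L.edges) L.label L.center

theorem LocalAlgorithm.ofFun_localView {σ τ : Type} [Nonempty σ]
    {F : ℕ → ∀ V : Type, SimpleGraph V → (V → σ) → V → τ} {V : Type} (G : SimpleGraph V)
    {ident : V → ℕ} (hid : Function.Injective ident) (inp : V → σ) (t : ℕ)
    (hF : IsLocalFun t (F (Nat.card V))) (v : V) :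
    LocalAlgorithm.ofFun F (localView G ident inp t v) = F (Nat.card V) V G inp v := by
  refine hF V ℕ G inp _ _ ident hid v ?_
  refine AgreeUpTo.of_rank (fun u => G.edist v u) t ?_ ?_ ?_ t _ (by simp)
  · exact fun u w huw => SimpleGraph.edist_le_edist_add_one v huw
  · intro u hu
    have hex : ∃ x, ∃ d, (ident u, d, x) ∈ (localView G ident inp t v).nodes :=
      ⟨inp u, nodeDegree G u, u, hu, rfl⟩
    unfold LocalView.label
    rw [dif_pos hex]
    obtain ⟨d, u', -, h⟩ := hex.choose_spec
    simp only [Prod.mk.injEq] at h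
    rw [h.2.2, hid h.1]
  · intro u hu w'
    have hu' : G.edist v u < (t : ℕ∞) := by
      have hne : G.edist v u ≠ ⊤ :=
        ne_top_of_le_ne_top (ENat.natCast_ne_top t) (le_trans le_self_add hu)
      exact (ENat.add_one_le_iff hne).1 hu
    simp only [SimpleGraph.fromEdgeSet_adj]
    constructor
    · rintro ⟨⟨u₁, w₁, hadj, -, he⟩, -⟩
      rcases Sym2.eq_iff.1 he with ⟨h1, h2⟩ | ⟨h1, h2⟩
      · exact ⟨w₁, by rwa [hid h1], h2.symm⟩
      · exact ⟨u₁, by rw [hid h1]; exact hadj.symm, h2.symm⟩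
    · rintro ⟨w, hw, rfl⟩
      exact ⟨⟨u, w, hw, hu', rfl⟩, fun h => hw.ne (hid h)⟩

/-- A node cannot distinguish inputs that agree up to distance `t`. -/
theorem localView_congr {V σ : Type} (G : SimpleGraph V) (ident : V → ℕ) {inp inp' : V → σ}
    (t : ℕ) (v : V) (h : ∀ u, G.edist v u ≤ (t : ℕ∞) → inp u = inp' u) :
    localView G ident inp t v = localView G ident inp' t v := by
  unfold localView
  congr 1
  ext x
  constructor <;> rintro ⟨u, hu, rfl⟩
  · exact ⟨u, hu, by rw [h u hu]⟩
  · exact ⟨u, hu, by rw [h u hu]⟩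

/-- Since every node knows the number of nodes, optimal algorithms for the individual values of `n`
combine into one algorithm. -/
theorem LCL.exists_hasTimeComplexity {P : LCL} {Δ c : ℕ} {A : LocalAlgorithm P.Input P.Output}
    {s : ℕ → ℕ} (h : P.SolvedBy Δ c A s) : ∃ t, P.HasTimeComplexity Δ c t := by
  classical
  have hne : ∀ n, ∃ k, ∃ (A : LocalAlgorithm P.Input P.Output) (s : ℕ → ℕ),
      P.SolvedBy Δ c A s ∧ s n = k := fun n => ⟨s n, A, s, h, rfl⟩
  choose B u hB hu using fun n => Nat.find_spec (hne n)
  refine ⟨fun n => Nat.find (hne n), ⟨fun L => B L.size L, ?_⟩, ?_⟩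
  · intro V _ G hG hΔ ident hid hbd inp
    have := hB (Nat.card V) V G hG hΔ ident hid hbd inp
    rw [hu] at this
    exact this
  · rintro s' ⟨A', hA'⟩ n
    exact Nat.find_min' (hne n) ⟨A', s', hA', rfl⟩

/-- The nodes of a finite graph can be given identifiers from `{1, …, n ^ c}`. -/
theorem exists_identifiers (V : Type) [Finite V] {c : ℕ} (hc : 1 ≤ c) :
    ∃ ident : V → ℕ, Function.Injective ident ∧ ∀ v, 1 ≤ ident v ∧ ident v ≤ Nat.card V ^ c := by
  let e := Finite.equivFin V
  refine ⟨fun v => (e v : ℕ) + 1, fun v w h => ?_, fun v => ⟨by simp, ?_⟩⟩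
  · exact e.injective (Fin.ext (by simpa using h))
  · exact (Nat.succ_le_of_lt (e v).isLt).trans (Nat.le_self_pow (by omega) _)

/-! ### The problem -/

/-- Input labels. A node has a level (`a + 1` for padding nodes), its two coordinates modulo 3
(`X` along the paths, `Z` for the depth in the tree), and a cell of a `p`-digit counter. -/
structure InLabel (p a : ℕ) where
  /-- the level in the tree; the value `a + 1` marks padding nodes -/
  lvl : Fin (a + 2)
  /-- the position along the path, modulo 3 -/
  X : ZMod 3
  /-- the depth in the tree, modulo 3 -/
  Z : ZMod 3
  /-- the cell's contribution to every digit of the counter -/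
  digit : Fin p → Bool
  /-- `carry j` tells that the next step of the counter carries into digit `j` -/
  carry : Fin (p + 1) → Bool
  /-- the bit to be copied along the path -/
  bit : Bool

/-- Output labels. -/
structure OutLabel where
  /-- a claim that the tree below the node contains an error -/
  err : Bool
  /-- the copied bit -/
  bit : Bool

instance (p a : ℕ) : Finite (InLabel p a) :=
  Finite.of_injective
    (fun l : InLabel p a => (l.lvl, l.X, l.Z, l.digit, l.carry, l.bit)) (by
      rintro ⟨⟩ ⟨⟩ h
      simpa using h)

instance : Finite OutLabel :=
  Finite.of_injective (fun l : OutLabel => (l.err, l.bit)) (by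
    rintro ⟨⟩ ⟨⟩ h
    simpa using h)

instance (p a : ℕ) : Nonempty (InLabel p a) :=
  ⟨⟨0, 0, 0, fun _ => false, fun _ => false, false⟩⟩

/-- Labels of a node and its copy at the next position of the path. -/
def XRel {p a : ℕ} (l l' : InLabel p a) : Prop :=
  (l.lvl : ℕ) ≤ a ∧ l.lvl = l'.lvl ∧ l'.X = l.X + 1

/-- Labels of a cell and the next cell of the same column. -/
def NextRel {p a : ℕ} (l l' : InLabel p a) : Prop :=
  1 ≤ (l.lvl : ℕ) ∧ (l.lvl : ℕ) ≤ a ∧ l.lvl = l'.lvl ∧ l'.X = l.X ∧ l'.Z = l.Z + 1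

/-- Labels of a node and the first cell of the column that it carries. -/
def BranchRel {p a : ℕ} (l l' : InLabel p a) : Prop :=
  (l'.lvl : ℕ) = l.lvl + 1 ∧ (l'.lvl : ℕ) ≤ a ∧ l'.X = l.X ∧ l'.Z = l.Z + 1

/-- Labels of a node and a child of it in the tree. -/
def ChildRel {p a : ℕ} (l l' : InLabel p a) : Prop := NextRel l l' ∨ BranchRel l l'

/-- One step of the counter at the cell `m`, whose predecessor in the column is `l` (or carries the
column, if `m` is its first cell); `m'` is the cell `m` one step later. A digit is stored in unary,
as the number of marked cells, so it is incremented by shifting the marks and adding one. -/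
def CounterStep {p a : ℕ} (l m m' : InLabel p a) : Prop :=
  ∀ j : Fin p, (m.carry j.castSucc = false → m'.digit j = m.digit j) ∧
    (m.carry j.succ = true → m'.digit j = false) ∧
    (m.carry j.castSucc = true → m.carry j.succ = false → NextRel l m → m'.digit j = l.digit j) ∧
    (m.carry j.castSucc = true → m.carry j.succ = false → BranchRel l m → m'.digit j = true)

/-- The counter never overflows, and carries happen only at digits whose cells are all marked. -/
def CounterCell {p a : ℕ} (l : InLabel p a) : Prop :=
  l.carry 0 = true ∧ l.carry (Fin.last p) = false ∧
    ∀ j : Fin p, l.carry j.succ = true → l.carry j.castSucc = true ∧ l.digit j = true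

/-- A digit that is incremented was not at its maximum; this is visible at the last cell. -/
def CounterTop {p a : ℕ} (l : InLabel p a) : Prop :=
  ∀ j : Fin p, l.carry j.castSucc = true → l.carry j.succ = false → l.digit j = false

section Relations

variable {p a : ℕ} {V : Type} (G : SimpleGraph V) (lab : V → InLabel p a)

/-- Adjacent nodes whose labels are in the relation `q`. -/
def LabelAdj (q : InLabel p a → InLabel p a → Prop) (u w : V) : Prop :=
  G.Adj u w ∧ q (lab u) (lab w)

/-- The input is locally correct at `v`. In this order: `v` has at most one parent; it carries a
column unless it is on the last level; its children follow it to the next position of the path and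
make a step of the counter there; carries are constant along columns; `v` is a correct cell of a
counter; and if it is the last cell of its column, then no digit that is at its maximum gets
incremented, and its copy at the next position is a last cell as well. -/
def Good (v : V) : Prop :=
  (∀ u, LabelAdj G lab (flip ChildRel) v u → ∀ u', LabelAdj G lab (flip ChildRel) v u' → u = u') ∧
  (((lab v).lvl : ℕ) < a → ∃ w, LabelAdj G lab BranchRel v w) ∧
  (∀ w, LabelAdj G lab ChildRel v w → ∀ v', LabelAdj G lab XRel v v' →
    ∃ w', LabelAdj G lab XRel w w' ∧ LabelAdj G lab ChildRel v' w' ∧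
      CounterStep (lab v) (lab w) (lab w')) ∧
  (∀ w, LabelAdj G lab NextRel v w → (lab w).carry = (lab v).carry) ∧
  (1 ≤ ((lab v).lvl : ℕ) → CounterCell (lab v)) ∧
  (1 ≤ ((lab v).lvl : ℕ) → (¬∃ w, LabelAdj G lab NextRel v w) →
    CounterTop (lab v) ∧
      ∀ v', LabelAdj G lab XRel v v' → ¬∃ w', LabelAdj G lab NextRel v' w')

/-- `u` is the predecessor of `v` on a path of roots. -/
def Linked (u v : V) : Prop :=
  LabelAdj G lab XRel u v ∧ ((lab v).lvl : ℕ) = 0 ∧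
    (∀ u', LabelAdj G lab (flip XRel) v u' → u' = u) ∧ ∀ v', LabelAdj G lab XRel u v' → v' = v

/-- The input is correct at all nodes that are reachable from `v` by at most `d` steps to a
child. -/
def Clean : ℕ → V → Prop
  | 0, v => Good G lab v
  | d + 1, v => Good G lab v ∧ ∀ w, LabelAdj G lab ChildRel v w → Clean d w

/-- The constraint at a node. Errors have to be traced down to an incorrect input, and the bit is
copied along the paths of roots, except at nodes that report an error. -/
def CopyOk (io : V → InLabel p a × OutLabel) (v : V) : Prop :=
  ((io v).2.err = true → ¬Good G (fun u => (io u).1) v ∨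
    ∃ w, LabelAdj G (fun u => (io u).1) ChildRel v w ∧ (io w).2.err = true) ∧
  ((io v).2.err = false → ∀ u, Linked G (fun u => (io u).1) u v → (io v).2.bit = (io u).2.bit) ∧
  ((¬∃ u, Linked G (fun u => (io u).1) u v) → (io v).2.bit = (io v).1.bit)

end Relations

/-! ### Locality of the constraint -/

section Locality

variable {p a : ℕ} {V W : Type} {G : SimpleGraph V} {lab : V → InLabel p a} {H : SimpleGraph W}
  {lab' : W → InLabel p a} {φ : V → W}

theorem AgreeUpTo.labelAdj_iff (hφ : Function.Injective φ) {s : ℕ} {u w : V}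
    (h : AgreeUpTo G lab H lab' φ (s + 1) u) (q : InLabel p a → InLabel p a → Prop) :
    LabelAdj H lab' q (φ u) (φ w) ↔ LabelAdj G lab q u w := by
  have : H.Adj (φ u) (φ w) ↔ G.Adj u w := by
    rw [h.2.1]
    exact ⟨fun ⟨x, hx, hxw⟩ => hφ hxw ▸ hx, fun hw => ⟨w, hw, rfl⟩⟩
  unfold LabelAdj
  rw [this]
  refine and_congr_right fun hw => ?_
  rw [h.label_eq, (h.adj hw).label_eq]

theorem AgreeUpTo.forall_iff (hφ : Function.Injective φ) {s : ℕ} {u : V}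
    (h : AgreeUpTo G lab H lab' φ (s + 1) u) {q : InLabel p a → InLabel p a → Prop}
    {P : V → Prop} {P' : W → Prop}
    (hP : ∀ w, AgreeUpTo G lab H lab' φ s w → LabelAdj G lab q u w → (P' (φ w) ↔ P w)) :
    (∀ w', LabelAdj H lab' q (φ u) w' → P' w') ↔ ∀ w, LabelAdj G lab q u w → P w := by
  constructor
  · exact fun h' w hw => (hP w (h.adj hw.1) hw).1 (h' _ ((h.labelAdj_iff hφ q).2 hw))
  · intro h' w' hw'
    obtain ⟨w, -, rfl⟩ := (h.2.1 w').1 hw'.1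
    have hw := (h.labelAdj_iff hφ q).1 hw'
    exact (hP w (h.adj hw.1) hw).2 (h' w hw)

theorem AgreeUpTo.exists_iff (hφ : Function.Injective φ) {s : ℕ} {u : V}
    (h : AgreeUpTo G lab H lab' φ (s + 1) u) {q : InLabel p a → InLabel p a → Prop}
    {P : V → Prop} {P' : W → Prop}
    (hP : ∀ w, AgreeUpTo G lab H lab' φ s w → LabelAdj G lab q u w → (P' (φ w) ↔ P w)) :
    (∃ w', LabelAdj H lab' q (φ u) w' ∧ P' w') ↔ ∃ w, LabelAdj G lab q u w ∧ P w := by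
  have := not_congr (h.forall_iff hφ (q := q) (P := fun w => ¬P w) (P' := fun w => ¬P' w)
    fun w hw hw' => not_congr (hP w hw hw'))
  simpa only [not_forall, not_not, exists_prop] using this

theorem AgreeUpTo.exists_iff' (hφ : Function.Injective φ) {s : ℕ} {u : V}
    (h : AgreeUpTo G lab H lab' φ (s + 1) u) (q : InLabel p a → InLabel p a → Prop) :
    (∃ w', LabelAdj H lab' q (φ u) w') ↔ ∃ w, LabelAdj G lab q u w := by
  have := h.exists_iff hφ (q := q) (P := fun _ => True) (P' := fun _ => True)
    fun _ _ _ => Iff.rfl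
  simpa only [and_true] using this

theorem AgreeUpTo.good_iff (hφ : Function.Injective φ) {v : V}
    (h : AgreeUpTo G lab H lab' φ 2 v) : Good H lab' (φ v) ↔ Good G lab v := by
  unfold Good
  rw [h.label_eq]
  refine and_congr ?_ (and_congr ?_ (and_congr ?_ (and_congr ?_ (and_congr Iff.rfl ?_))))
  · exact h.forall_iff hφ fun u _ _ => h.forall_iff hφ fun u' _ _ => hφ.eq_iff
  · exact imp_congr_right fun _ => h.exists_iff' hφ _
  · refine h.forall_iff hφ fun w hw _ => h.forall_iff hφ fun v' hv' _ => ?_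
    refine hw.exists_iff hφ fun w' hw' _ => ?_
    rw [hw.label_eq, hw'.label_eq, hv'.labelAdj_iff hφ]
  · refine h.forall_iff hφ fun w hw _ => ?_
    rw [hw.label_eq]
  · refine imp_congr_right fun _ => imp_congr (not_congr (h.exists_iff' hφ _))
      (and_congr_right fun _ => ?_)
    exact h.forall_iff hφ fun v' hv' _ => not_congr (hv'.exists_iff' hφ _)

theorem AgreeUpTo.clean_iff (hφ : Function.Injective φ) {d : ℕ} {v : V}
    (h : AgreeUpTo G lab H lab' φ (d + 2) v) : Clean H lab' d (φ v) ↔ Clean G lab d v := by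
  induction d generalizing v with
  | zero => exact h.good_iff hφ
  | succ d ih =>
    unfold Clean
    rw [(h.mono (by omega)).good_iff hφ]
    refine and_congr_right fun _ => ?_
    exact AgreeUpTo.forall_iff (s := d + 2) hφ h fun w hw _ => ih hw

theorem AgreeUpTo.linked_iff (hφ : Function.Injective φ) {u v : V}
    (h : AgreeUpTo G lab H lab' φ 2 v) :
    Linked H lab' (φ u) (φ v) ↔ Linked G lab u v := by
  have hflip : ∀ {V : Type} (G : SimpleGraph V) (lab : V → InLabel p a) (u v : V),
      Linked G lab u v ↔ LabelAdj G lab (flip XRel) v u ∧ ((lab v).lvl : ℕ) = 0 ∧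
        (∀ u', LabelAdj G lab (flip XRel) v u' → u' = u) ∧
          ∀ v', LabelAdj G lab XRel u v' → v' = v := by
    intro V G lab u v
    unfold Linked LabelAdj
    rw [G.adj_comm]
    rfl
  rw [hflip, hflip, h.label_eq, h.labelAdj_iff hφ]
  refine and_congr_right fun huv => and_congr_right fun _ => and_congr ?_ ?_
  · exact h.forall_iff hφ fun u' _ _ => hφ.eq_iff
  · exact (h.adj huv.1).forall_iff hφ fun v' _ _ => hφ.eq_iff

theorem AgreeUpTo.exists_linked_iff (hφ : Function.Injective φ) {s : ℕ} {v : V}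
    (h : AgreeUpTo G lab H lab' φ (s + 2) v) {P : V → Prop} {P' : W → Prop}
    (hP : ∀ u, AgreeUpTo G lab H lab' φ (s + 1) u → Linked G lab u v → (P' (φ u) ↔ P u)) :
    (∃ u', Linked H lab' u' (φ v) ∧ P' u') ↔ ∃ u, Linked G lab u v ∧ P u := by
  have h2 := h.mono (show 2 ≤ s + 2 by omega)
  constructor
  · rintro ⟨u', hu', hP'⟩
    obtain ⟨u, hu, rfl⟩ := (h.2.1 u').1 hu'.1.1.symm
    have hl := (h2.linked_iff hφ).1 hu'
    exact ⟨u, hl, (hP u (h.adj hu) hl).1 hP'⟩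
  · rintro ⟨u, hu, hPu⟩
    exact ⟨φ u, (h2.linked_iff hφ).2 hu, (hP u (h.adj hu.1.1.symm) hu).2 hPu⟩

theorem AgreeUpTo.exists_linked_iff' (hφ : Function.Injective φ) {v : V}
    (h : AgreeUpTo G lab H lab' φ 2 v) :
    (∃ u', Linked H lab' u' (φ v)) ↔ ∃ u, Linked G lab u v := by
  have := AgreeUpTo.exists_linked_iff (s := 0) hφ h (P := fun _ => True) (P' := fun _ => True)
    fun _ _ _ => Iff.rfl
  simpa only [and_true] using this

end Locality

theorem copyOk_isLocal (p a : ℕ) :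
    IsLocalFun 2 (fun V (G : SimpleGraph V) (io : V → InLabel p a × OutLabel) v =>
      CopyOk G io v) := by
  intro V W G io H io' φ hφ v h
  have h1 := h.comp_label Prod.fst
  refine propext ?_
  change CopyOk H io' (φ v) ↔ CopyOk G io v
  unfold CopyOk
  rw [h.label_eq, h1.good_iff hφ, h1.exists_linked_iff' hφ]
  refine and_congr (imp_congr_right fun _ => or_congr_right ?_) (and_congr_left fun _ =>
    imp_congr_right fun _ => ?_)
  · have : ∀ w, LabelAdj G (fun u => (io u).1) ChildRel v w →
        (((io' (φ w)).2.err = true) ↔ (io w).2.err = true) := fun w hw => by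
      rw [(h.adj hw.1).label_eq]
    exact h1.exists_iff hφ fun w _ hw => this w hw
  · constructor
    · intro h' u hu
      rw [h' (φ u) ((h1.linked_iff hφ).2 hu), (h.adj hu.1.1.symm).label_eq]
    · intro h' u' hu'
      obtain ⟨u, hu, rfl⟩ := (h.2.1 u').1 hu'.1.1.symm
      rw [h' u ((h1.linked_iff hφ).1 hu'), (h.adj hu).label_eq]

/-- The problem with complexity `n ^ (p / (p + a))`. -/
def copyLCL (p a : ℕ) : LCL :=
  LCL.ofLocal (InLabel p a) OutLabel 2 (fun _ G io v => CopyOk G io v)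

/-! ### Counters -/

theorem sum_pred_mul_pow_lt (B p : ℕ) : ∑ j : Fin p, B * (B + 1) ^ (j : ℕ) < (B + 1) ^ p := by
  induction p with
  | zero => simp
  | succ p ih =>
    rw [Fin.sum_univ_castSucc]
    simp only [Fin.val_castSucc, Fin.val_last]
    calc _ < (B + 1) ^ p + B * (B + 1) ^ p := by gcongr
      _ = (B + 1) ^ (p + 1) := by ring

/-- Adding one to a number in base `ℓ + 1`, with `c j` the carry into digit `j`. -/
theorem sum_digits_step (ℓ : ℕ) : ∀ (p : ℕ) (d d' : Fin p → ℕ) (c : Fin (p + 1) → Bool),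
    (∀ j, c j.castSucc = false → d' j = d j) →
    (∀ j, c j.succ = true → c j.castSucc = true ∧ d j = ℓ ∧ d' j = 0) →
    (∀ j, c j.castSucc = true → c j.succ = false → d' j = d j + 1) →
    ∑ j, d' j * (ℓ + 1) ^ (j : ℕ) + (c (Fin.last p)).toNat * (ℓ + 1) ^ p =
      ∑ j, d j * (ℓ + 1) ^ (j : ℕ) + (c 0).toNat
  | 0, d, d', c, _, _, _ => by simp
  | p + 1, d, d', c, h0, h1, h2 => by
    have ih := sum_digits_step ℓ p (fun j => d j.castSucc) (fun j => d' j.castSucc)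
      (fun j => c j.castSucc) (fun j => h0 j.castSucc) (fun j => h1 j.castSucc)
      (fun j => h2 j.castSucc)
    rw [Fin.sum_univ_castSucc, Fin.sum_univ_castSucc]
    simp only [Fin.val_castSucc, Fin.val_last, Fin.castSucc_zero] at ih ⊢
    have e0 := h0 (Fin.last p)
    have e1 := h1 (Fin.last p)
    have e2 := h2 (Fin.last p)
    rw [Fin.succ_last] at e1 e2
    cases hc : c (Fin.last p).castSucc <;> cases hc' : c (Fin.last (p + 1)) <;>
      rw [hc] at ih <;>
      simp only [Bool.toNat_false, Bool.toNat_true, zero_mul, one_mul, add_zero] at ih ⊢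
    · rw [e0 hc]; linarith
    · exact absurd (e1 hc').1 (by simp [hc])
    · rw [e2 hc hc', add_mul]; linarith
    · rw [(e1 hc').2.1, (e1 hc').2.2, zero_mul, pow_succ]; linarith

/-- A `p`-digit counter in base `ℓ + 1` that does not overflow makes fewer than `(ℓ + 1) ^ p`
steps. -/
theorem counter_steps_lt {p ℓ K : ℕ} (d : ℕ → Fin p → ℕ) (c : ℕ → Fin (p + 1) → Bool)
    (hd : ∀ j, d K j ≤ ℓ)
    (hc : ∀ k < K, c k 0 = true ∧ c k (Fin.last p) = false)
    (h0 : ∀ k < K, ∀ j, c k j.castSucc = false → d (k + 1) j = d k j)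
    (h1 : ∀ k < K, ∀ j, c k j.succ = true →
      c k j.castSucc = true ∧ d k j = ℓ ∧ d (k + 1) j = 0)
    (h2 : ∀ k < K, ∀ j, c k j.castSucc = true → c k j.succ = false → d (k + 1) j = d k j + 1) :
    K < (ℓ + 1) ^ p := by
  have key : ∀ k ≤ K, k ≤ ∑ j, d k j * (ℓ + 1) ^ (j : ℕ) := by
    intro k
    induction k with
    | zero => simp
    | succ k ih =>
      intro hk
      have hk' : k < K := hk
      have := sum_digits_step ℓ p (d k) (d (k + 1)) (c k) (h0 k hk') (h1 k hk') (h2 k hk')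
      rw [(hc k hk').1, (hc k hk').2] at this
      simp only [Bool.toNat_false, zero_mul, add_zero, Bool.toNat_true] at this
      rw [this]
      have := ih hk'.le
      omega
  refine lt_of_le_of_lt ((key K le_rfl).trans ?_) (sum_pred_mul_pow_lt ℓ p)
  gcongr with j
  exact hd j

/-! ### Large trees over long error-free paths -/

section Ribbon

variable {p a : ℕ} {V : Type} {G : SimpleGraph V} {lab : V → InLabel p a}

theorem Clean.good {d : ℕ} {v : V} (h : Clean G lab d v) : Good G lab v := by
  cases d with
  | zero => exact h
  | succ d => exact h.1

theorem Clean.of_succ {d : ℕ} {v : V} (h : Clean G lab (d + 1) v) : Clean G lab d v := by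
  induction d generalizing v with
  | zero => exact h.1
  | succ d ih => exact ⟨h.1, fun w hw => ih (h.2 w hw)⟩

theorem Clean.mono {d e : ℕ} (hde : d ≤ e) {v : V} (h : Clean G lab e v) : Clean G lab d v := by
  induction e, hde using Nat.le_induction with
  | base => exact h
  | succ e _ ih => exact ih h.of_succ

theorem ChildRel.next {l l' : InLabel p a} (h : ChildRel l l') (hl : l.lvl = l'.lvl) :
    NextRel l l' := by
  rcases h with h | h
  · exact h
  · have := h.1
    rw [hl] at this
    omega

theorem ChildRel.branch {l l' : InLabel p a} (h : ChildRel l l')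
    (hl : (l'.lvl : ℕ) = l.lvl + 1) : BranchRel l l' := by
  rcases h with h | h
  · have := h.2.2.1
    rw [this] at hl
    omega
  · exact h

/-- A path of `K` steps along which all trees are correct up to depth `d`. -/
structure Ribbon (G : SimpleGraph V) (lab : V → InLabel p a) (K d : ℕ) (s : ℕ → V) : Prop where
  step : ∀ k < K, LabelAdj G lab XRel (s k) (s (k + 1))
  clean : ∀ k ≤ K, Clean G lab d (s k)

theorem Ribbon.lvl_eq {K d : ℕ} {s : ℕ → V} (hs : Ribbon G lab K d s) {k : ℕ} (hk : k ≤ K) :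
    (lab (s k)).lvl = (lab (s 0)).lvl := by
  induction k with
  | zero => rfl
  | succ k ih => rw [← ih (by omega), (hs.step k hk).2.2.1]

theorem Ribbon.mono {K d e : ℕ} (hde : d ≤ e) {s : ℕ → V} (hs : Ribbon G lab K e s) :
    Ribbon G lab K d s :=
  ⟨hs.step, fun k hk => (hs.clean k hk).mono hde⟩

/-- A child of the first node of a path extends to a parallel path of children. -/
theorem Ribbon.lift {K d : ℕ} {s : ℕ → V} (hs : Ribbon G lab K (d + 1) s) {w : V}
    (hw : LabelAdj G lab ChildRel (s 0) w) :
    ∃ y : ℕ → V, y 0 = w ∧ Ribbon G lab K d y ∧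
      (∀ k ≤ K, LabelAdj G lab ChildRel (s k) (y k)) ∧
      ∀ k < K, CounterStep (lab (s k)) (lab (y k)) (lab (y (k + 1))) := by
  induction K generalizing s w with
  | zero =>
    refine ⟨fun _ => w, rfl, ⟨by simp, fun k hk => ?_⟩, fun k hk => ?_, by simp⟩
    · exact (hs.clean 0 le_rfl).2 w hw
    · rwa [Nat.le_zero.1 hk]
  | succ K ih =>
    obtain ⟨w', hww', hsw', hstep⟩ :=
      (hs.clean 0 (by omega)).good.2.2.1 w hw (s 1) (hs.step 0 (by omega))
    obtain ⟨y, hy0, hy, hch, hst⟩ := ih (s := fun k => s (k + 1))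
      ⟨fun k hk => hs.step (k + 1) (by omega), fun k hk => hs.clean (k + 1) (by omega)⟩ hsw'
    refine ⟨fun k => Nat.casesOn k w y, rfl, ⟨?_, ?_⟩, ?_, ?_⟩
    · rintro (_ | k) hk
      · change LabelAdj G lab XRel w (y 0)
        rwa [hy0]
      · exact hy.step k (by omega)
    · rintro (_ | k) hk
      · exact (hs.clean 0 (by omega)).2 w hw
      · exact hy.clean k (by omega)
    · rintro (_ | k) hk
      · exact hw
      · exact hch k (by omega)
    · rintro (_ | k) hk
      · change CounterStep (lab (s 0)) (lab w) (lab (y 0))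
        rwa [hy0]
      · exact hst k (by omega)

/-- The paths `y` are formed by cell number `i` of a column, counted from `0`. The numbers `D k j`
are the values of digit `j` after `k` steps, restricted to the cells `0, …, i`. -/
def ColumnCell (lab : V → InLabel p a) (K i : ℕ) (y : ℕ → V) : Prop :=
  ∃ D : ℕ → Fin p → ℕ, (∀ k j, D k j ≤ i + 1) ∧ ∀ k < K, ∀ j : Fin p,
    ((lab (y k)).carry j.castSucc = false → D (k + 1) j = D k j) ∧
    ((lab (y k)).carry j.succ = true → D k j = i + 1 ∧ D (k + 1) j = 0) ∧
    ((lab (y k)).carry j.castSucc = true → (lab (y k)).carry j.succ = false →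
      D (k + 1) j + ((lab (y k)).digit j).toNat = D k j + 1)

theorem Ribbon.exists_first_cell {K d : ℕ} {s : ℕ → V} (hs : Ribbon G lab K (d + 1) s)
    (hl : ((lab (s 0)).lvl : ℕ) < a) :
    ∃ y, Ribbon G lab K d y ∧ LabelAdj G lab BranchRel (s 0) (y 0) ∧ ColumnCell lab K 0 y := by
  obtain ⟨w, hw⟩ := (hs.clean 0 (by omega)).good.2.1 hl
  obtain ⟨y, rfl, hy, hch, hst⟩ := hs.lift (w := w) ⟨hw.1, Or.inr hw.2⟩
  refine ⟨y, hy, hw, fun k j => ((lab (y k)).digit j).toNat, fun k j => Bool.toNat_le _, ?_⟩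
  intro k hk j
  have hbr : BranchRel (lab (s k)) (lab (y k)) := (hch k hk.le).2.branch (by
    rw [hy.lvl_eq hk.le, hs.lvl_eq hk.le]
    exact hw.2.1)
  have hcell := (hy.clean k hk.le).good.2.2.2.2.1 (by have := hbr.1; omega)
  obtain ⟨h1, h2, -, h4⟩ := hst k hk j
  refine ⟨fun hc => by beta_reduce; rw [h1 hc], fun hc => ?_, fun hc hc' => ?_⟩
  · beta_reduce
    rw [h2 hc, (hcell.2.2 j hc).2]
    simp
  · beta_reduce
    rw [h4 hc hc' hbr, Bool.toNat_true, add_comm]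

/-- A column over a long path cannot be short: otherwise its counter would overflow. -/
theorem Ribbon.exists_next_cell {K d i : ℕ} {y : ℕ → V} (hy : Ribbon G lab K (d + 1) y)
    (hl : 1 ≤ ((lab (y 0)).lvl : ℕ)) (hcol : ColumnCell lab K i y) (hK : (i + 2) ^ p ≤ K) :
    ∃ y', Ribbon G lab K d y' ∧ LabelAdj G lab NextRel (y 0) (y' 0) ∧
      ColumnCell lab K (i + 1) y' := by
  obtain ⟨D, hD, hstep⟩ := hcol
  have hlk : ∀ k ≤ K, 1 ≤ ((lab (y k)).lvl : ℕ) := fun k hk => by rwa [hy.lvl_eq hk]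
  have hcell : ∀ k ≤ K, CounterCell (lab (y k)) := fun k hk =>
    (hy.clean k hk).good.2.2.2.2.1 (hlk k hk)
  have hnext : ∃ w, LabelAdj G lab NextRel (y 0) w := by
    by_contra hno
    -- then the cells `0, …, i` form the whole column, and `D` is a complete counter
    have hno' : ∀ k ≤ K, ¬∃ w, LabelAdj G lab NextRel (y k) w := by
      intro k
      induction k with
      | zero => exact fun _ => hno
      | succ k ih =>
        intro hk
        exact ((hy.clean k (by omega)).good.2.2.2.2.2 (hlk k (by omega)) (ih (by omega))).2 _
          (hy.step k hk)
    refine absurd hK (not_le.2 ?_)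
    refine counter_steps_lt (ℓ := i + 1) D (fun k => (lab (y k)).carry) (hD K) ?_ ?_ ?_ ?_
    · exact fun k hk => ⟨(hcell k hk.le).1, (hcell k hk.le).2.1⟩
    · exact fun k hk j => (hstep k hk j).1
    · exact fun k hk j hc => ⟨((hcell k hk.le).2.2 j hc).1, (hstep k hk j).2.1 hc⟩
    · intro k hk j hc hc'
      have htop := ((hy.clean k hk.le).good.2.2.2.2.2 (hlk k hk.le) (hno' k hk.le)).1 j hc hc'
      have := (hstep k hk j).2.2 hc hc'
      rwa [htop] at this
  obtain ⟨w, hw⟩ := hnext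
  obtain ⟨y', rfl, hy', hch, hst⟩ := hy.lift (w := w) ⟨hw.1, Or.inl hw.2⟩
  refine ⟨y', hy', hw, fun k j => D k j + ((lab (y' k)).digit j).toNat,
    fun k j => add_le_add (hD k j) (Bool.toNat_le _), ?_⟩
  intro k hk j
  have hnx : NextRel (lab (y k)) (lab (y' k)) := (hch k hk.le).2.next (by
    rw [hy.lvl_eq hk.le, hy'.lvl_eq hk.le]
    exact hw.2.2.2.1)
  have hcarry : (lab (y' k)).carry = (lab (y k)).carry :=
    (hy.clean k hk.le).good.2.2.2.1 _ ⟨(hch k hk.le).1, hnx⟩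
  have hcell' := (hy'.clean k hk.le).good.2.2.2.2.1 (by rw [← hnx.2.2.1]; exact hlk k hk.le)
  obtain ⟨h1, h2, h3, -⟩ := hst k hk j
  obtain ⟨e1, e2, e3⟩ := hstep k hk j
  rw [← hcarry] at e1 e2 e3
  refine ⟨fun hc => by beta_reduce; rw [h1 hc, e1 hc], fun hc => ?_, fun hc hc' => ?_⟩
  · beta_reduce
    rw [h2 hc, (hcell'.2.2 j hc).2, (e2 hc).1, (e2 hc).2]
    simp
  · have := e3 hc hc'
    beta_reduce
    rw [h3 hc hc' hnx]
    omega

/-- The nodes of level `ℓ` that start a path as in `Ribbon`. -/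
def Front (G : SimpleGraph V) (lab : V → InLabel p a) (K d ℓ : ℕ) : Set V :=
  {w | ((lab w).lvl : ℕ) = ℓ ∧ ∃ s : ℕ → V, s 0 = w ∧ Ribbon G lab K d s}

/-- Over an error-free path of length `h ^ p`, every column has at least `h` cells. The cells are
found one after the other, with the counter restricted to those found so far. -/
theorem exists_column {K d ℓ h : ℕ} (hℓ : ℓ < a) (hK : h ^ p ≤ K) {u : V}
    (hu : u ∈ Front G lab K (d + h) ℓ) {i : ℕ} (hi : i < h) :
    ∃ (g y : ℕ → V), LabelAdj G lab BranchRel u (g 0) ∧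
      (∀ j < i, LabelAdj G lab NextRel (g j) (g (j + 1))) ∧
      (∀ j ≤ i, g j ∈ Front G lab K d (ℓ + 1)) ∧
      y 0 = g i ∧ Ribbon G lab K (d + h - 1 - i) y ∧ ColumnCell lab K i y := by
  induction i with
  | zero =>
    obtain ⟨hul, s, rfl, hs⟩ := hu
    obtain ⟨y, hy, hbr, hcol⟩ := Ribbon.exists_first_cell (d := d + h - 1)
      (hs.mono (by omega)) (hul ▸ hℓ)
    refine ⟨fun _ => y 0, y, hbr, by simp, fun j _ => ⟨?_, y, rfl, hy.mono (by omega)⟩, rfl, hy,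
      hcol⟩
    rw [hbr.2.1, hul]
  | succ i ih =>
    obtain ⟨g, y, hbr, hnx, hfr, hyg, hy, hcol⟩ := ih (by omega)
    have hlvl := (hfr i le_rfl).1
    obtain ⟨y', hy', hnx', hcol'⟩ := Ribbon.exists_next_cell (d := d + h - 1 - (i + 1))
      (hy.mono (by omega)) (by rw [hyg, hlvl]; omega) hcol
      ((Nat.pow_le_pow_left (by omega) p).trans hK)
    have hlvl' : ((lab (y' 0)).lvl : ℕ) = ℓ + 1 := by
      rw [← hnx'.2.2.2.1, hyg, hlvl]
    refine ⟨fun j => if j ≤ i then g j else y' 0, y', by simpa using hbr, ?_, ?_, by simp,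
      hy', hcol'⟩
    · intro j hj
      beta_reduce
      rcases Nat.lt_or_ge j i with hji | hji
      · rw [if_pos (by omega), if_pos (by omega)]
        exact hnx j hji
      · obtain rfl : j = i := by omega
        rw [if_pos le_rfl, if_neg (by omega), ← hyg]
        exact hnx'
    · intro j hj
      beta_reduce
      by_cases hji : j ≤ i
      · rw [if_pos hji]
        exact hfr j hji
      · rw [if_neg hji]
        exact ⟨hlvl', y', rfl, hy'.mono (by omega)⟩

/-- Columns of different nodes are disjoint, because a correct node has only one parent. -/
theorem mul_card_front_le [Finite V] {K d ℓ h : ℕ} (hℓ : ℓ < a) (hK : h ^ p ≤ K) :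
    Nat.card (Front G lab K (d + h) ℓ) * h ≤ Nat.card (Front G lab K d (ℓ + 1)) := by
  rcases Nat.eq_zero_or_pos h with rfl | hh
  · simp
  have hex : ∀ u : Front G lab K (d + h) ℓ, ∃ g : ℕ → V, LabelAdj G lab BranchRel u (g 0) ∧
      (∀ j, j + 1 < h → LabelAdj G lab NextRel (g j) (g (j + 1))) ∧
      ∀ j < h, g j ∈ Front G lab K d (ℓ + 1) := by
    intro u
    obtain ⟨g, -, h1, h2, h3, -⟩ := exists_column hℓ hK u.2 (show h - 1 < h by omega)
    exact ⟨g, h1, fun j hj => h2 j (by omega), fun j hj => h3 j (by omega)⟩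
  choose g hbr hnx hfr using hex
  have hgood : ∀ u, ∀ j < h, Good G lab (g u j) := by
    intro u j hj
    obtain ⟨-, s, hs, hr⟩ := hfr u j hj
    exact hs ▸ (hr.clean 0 (by omega)).good
  have hpar : ∀ u, ∀ j < h, ∀ x x', LabelAdj G lab ChildRel x (g u j) →
      LabelAdj G lab ChildRel x' (g u j) → x = x' := fun u j hj x x' hx hx' =>
    (hgood u j hj).1 x ⟨hx.1.symm, hx.2⟩ x' ⟨hx'.1.symm, hx'.2⟩
  have hinj : ∀ i < h, ∀ j < h, ∀ u u', g u i = g u' j → u = u' ∧ i = j := by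
    intro i
    induction i with
    | zero =>
      intro hi j hj u u' he
      have hb : LabelAdj G lab ChildRel u (g u 0) := ⟨(hbr u).1, Or.inr (hbr u).2⟩
      cases j with
      | zero =>
        have hb' : LabelAdj G lab ChildRel u' (g u' 0) := ⟨(hbr u').1, Or.inr (hbr u').2⟩
        exact ⟨Subtype.ext (hpar u' 0 hi _ _ (he ▸ hb) hb'), rfl⟩
      | succ j =>
        have hn := hnx u' j hj
        have := hpar u' _ hj _ _ (he ▸ hb) ⟨hn.1, Or.inl hn.2⟩
        have h1 := u.2.1
        rw [this, (hfr u' j (by omega)).1] at h1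
        omega
    | succ i ih =>
      intro hi j hj u u' he
      have hn := hnx u i hi
      have hb : LabelAdj G lab ChildRel (g u i) (g u (i + 1)) := ⟨hn.1, Or.inl hn.2⟩
      cases j with
      | zero =>
        have hb' : LabelAdj G lab ChildRel u' (g u' 0) := ⟨(hbr u').1, Or.inr (hbr u').2⟩
        have := hpar u' _ hj _ _ hb' (he ▸ hb)
        have h1 := u'.2.1
        rw [this, (hfr u i (by omega)).1] at h1
        omega
      | succ j =>
        have hn' := hnx u' j hj
        have hb' : LabelAdj G lab ChildRel (g u' j) (g u' (j + 1)) := ⟨hn'.1, Or.inl hn'.2⟩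
        obtain ⟨h1, h2⟩ := ih (by omega) j (by omega) u u' (hpar u' _ hj _ _ (he ▸ hb) hb')
        exact ⟨h1, by rw [h2]⟩
  have hcard := Nat.card_le_card_of_injective
    (fun x : Front G lab K (d + h) ℓ × Fin h =>
      (⟨g x.1 x.2, hfr x.1 x.2 x.2.isLt⟩ : Front G lab K d (ℓ + 1))) (by
      rintro ⟨u, i⟩ ⟨u', j⟩ he
      obtain ⟨h1, h2⟩ := hinj i i.isLt j j.isLt u u' (congrArg Subtype.val he)
      exact Prod.ext h1 (Fin.ext h2))
  rwa [Nat.card_prod, Nat.card_fin] at hcard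

/-- Every starting node of an error-free path of length `h ^ p` comes with its own `h ^ a`
nodes. -/
theorem card_front_mul_pow_le [Finite V] {K h : ℕ} (hK : h ^ p ≤ K) :
    Nat.card (Front G lab K (a * h) 0) * h ^ a ≤ Nat.card V := by
  have key : ∀ ℓ ≤ a, Nat.card (Front G lab K (a * h) 0) * h ^ ℓ ≤
      Nat.card (Front G lab K ((a - ℓ) * h) ℓ) := by
    intro ℓ
    induction ℓ with
    | zero => simp
    | succ ℓ ih =>
      intro hℓ
      have hd : (a - ℓ) * h = (a - (ℓ + 1)) * h + h := by
        rw [← Nat.succ_mul]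
        congr 1
        omega
      calc _ = Nat.card (Front G lab K (a * h) 0) * h ^ ℓ * h := by ring
        _ ≤ Nat.card (Front G lab K ((a - ℓ) * h) ℓ) * h := by gcongr; exact ih (by omega)
        _ ≤ _ := by rw [hd]; exact mul_card_front_le hℓ hK
  exact (key a le_rfl).trans (Finite.card_subtype_le _)

end Ribbon

/-! ### The algorithm -/

section Algorithm

variable {p a : ℕ} {V : Type} (G : SimpleGraph V) (lab : V → InLabel p a)

/-- A node at which the copied bit may be chosen afresh: its tree has a visible error, or it has no
predecessor. -/
def Anchor (d : ℕ) (v : V) : Prop := ¬Clean G lab d v ∨ ¬∃ u, Linked G lab u v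

/-- The first anchor on the backward path from `v` is at most `k` steps away, and it has the bit
`true`. -/
def AnchorBit (d : ℕ) : ℕ → V → Prop
  | 0, v => Anchor G lab d v ∧ (lab v).bit = true
  | k + 1, v => (Anchor G lab d v ∧ (lab v).bit = true) ∨
      (¬Anchor G lab d v ∧ ∃ u, Linked G lab u v ∧ AnchorBit d k u)

/-- The output of the algorithm, with `h` the length of the columns that it takes into account. -/
noncomputable def copyOutput (h : ℕ) (v : V) : OutLabel :=
  open Classical in
  { err := decide (¬Clean G lab (a * h) v)
    bit := decide (AnchorBit G lab (a * h) (2 * h ^ p) v) }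

variable {G lab}

theorem AgreeUpTo.anchor_iff {W : Type} {H : SimpleGraph W} {lab' : W → InLabel p a} {φ : V → W}
    (hφ : Function.Injective φ) {d : ℕ} {v : V} (h : AgreeUpTo G lab H lab' φ (d + 2) v) :
    Anchor H lab' d (φ v) ↔ Anchor G lab d v := by
  unfold Anchor
  rw [h.clean_iff hφ, (h.mono (by omega)).exists_linked_iff' hφ]

theorem AgreeUpTo.anchorBit_iff {W : Type} {H : SimpleGraph W} {lab' : W → InLabel p a} {φ : V → W}
    (hφ : Function.Injective φ) {d k : ℕ} {v : V} (h : AgreeUpTo G lab H lab' φ (k + d + 2) v) :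
    AnchorBit H lab' d k (φ v) ↔ AnchorBit G lab d k v := by
  induction k generalizing v with
  | zero =>
    unfold AnchorBit
    rw [(h.mono (by omega)).anchor_iff hφ, h.label_eq]
  | succ k ih =>
    unfold AnchorBit
    rw [(h.mono (by omega)).anchor_iff hφ, h.label_eq]
    refine or_congr_right (and_congr_right fun _ => ?_)
    refine AgreeUpTo.exists_linked_iff (s := k + d + 1) hφ (h.mono (by omega)) fun u hu _ => ?_
    exact ih hu

theorem copyOutput_isLocal (p a h : ℕ) :
    IsLocalFun (2 * h ^ p + a * h + 2)
      (fun V (G : SimpleGraph V) (lab : V → InLabel p a) v => copyOutput G lab h v) := by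
  intro V W G lab H lab' φ hφ v hag
  change copyOutput H lab' h (φ v) = copyOutput G lab h v
  have h1 := (hag.mono (show a * h + 2 ≤ _ by omega)).clean_iff hφ
  have h2 := hag.anchorBit_iff hφ
  exact congrArg₂ OutLabel.mk (decide_eq_decide.2 (not_congr h1)) (decide_eq_decide.2 h2)

theorem Linked.unique {u u' v : V} (h : Linked G lab u v) (h' : Linked G lab u' v) : u' = u :=
  h.2.2.1 u' ⟨h'.1.1.symm, h'.1.2⟩

/-- A long error-free path of roots requires many nodes. -/
theorem pow_le_card_of_path [Finite V] {h : ℕ} (s : ℕ → V)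
    (hinj : ∀ i < 2 * h ^ p, ∀ j < 2 * h ^ p, s i = s j → i = j)
    (hlink : ∀ i < 2 * h ^ p, Linked G lab (s (i + 1)) (s i))
    (hclean : ∀ i < 2 * h ^ p, Clean G lab (a * h) (s i)) : h ^ (p + a) ≤ Nat.card V := by
  rw [pow_add]
  refine le_trans ?_ (card_front_mul_pow_le (G := G) (lab := lab) (le_refl (h ^ p)))
  gcongr
  -- each of the `h ^ p` nodes farthest back still has `h ^ p` error-free steps ahead of it
  have hmem : ∀ i : Fin (h ^ p), s (i + h ^ p) ∈ Front G lab (h ^ p) (a * h) 0 := by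
    intro i
    have hi := i.isLt
    refine ⟨(hlink _ (by omega)).2.1, fun k => s (i + h ^ p - k), rfl, ⟨fun k hk => ?_,
      fun k hk => hclean _ (by omega)⟩⟩
    have := (hlink (i + h ^ p - (k + 1)) (by omega)).1
    rwa [show i + h ^ p - (k + 1) + 1 = i + h ^ p - k by omega] at this
  have := Nat.card_le_card_of_injective (fun i => (⟨_, hmem i⟩ : Front G lab (h ^ p) (a * h) 0))
    (by
      intro i j hij
      have := hinj _ (by omega) _ (by omega) (congrArg Subtype.val hij)
      exact Fin.ext (by omega))
  rwa [Nat.card_fin] at this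

theorem AnchorBit.succ {d k : ℕ} {v : V} (h : AnchorBit G lab d k v) :
    AnchorBit G lab d (k + 1) v := by
  induction k generalizing v with
  | zero => exact Or.inl h
  | succ k ih =>
    rcases h with h | ⟨h, u, hu, hb⟩
    · exact Or.inl h
    · exact Or.inr ⟨h, u, hu, ih hb⟩

theorem AnchorBit.of_succ {d k : ℕ} {v : V} (h : AnchorBit G lab d (k + 1) v) :
    AnchorBit G lab d k v ∨ ∃ s : ℕ → V, s 0 = v ∧
      (∀ i ≤ k, ¬Anchor G lab d (s i) ∧ Linked G lab (s (i + 1)) (s i)) ∧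
      Anchor G lab d (s (k + 1)) := by
  induction k generalizing v with
  | zero =>
    rcases h with h | ⟨h, u, hu, hb⟩
    · exact Or.inl h
    · refine Or.inr ⟨fun i => Nat.casesOn i v fun _ => u, rfl, fun i hi => ?_, hb.1⟩
      obtain rfl := Nat.le_zero.1 hi
      exact ⟨h, hu⟩
  | succ k ih =>
    rcases h with h | ⟨h, u, hu, hb⟩
    · exact Or.inl (Or.inl h)
    · rcases ih hb with hb | ⟨s, hs, hs', hs''⟩
      · exact Or.inl (Or.inr ⟨h, u, hu, hb⟩)
      · refine Or.inr ⟨fun i => Nat.casesOn i v s, rfl, ?_, hs''⟩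
        rintro (_ | i) hi
        · exact ⟨h, by rwa [← hs] at hu⟩
        · exact hs' i (by omega)

/-- The choice of the horizon `2 * h ^ p` does not matter: a first anchor at exactly that distance
would give a path without repetitions and without visible errors, which is too large. -/
theorem AnchorBit.of_succ_of_card_lt [Finite V] {h k : ℕ} (hk : k + 1 = 2 * h ^ p)
    (hn : Nat.card V < h ^ (p + a)) {v : V} (hv : AnchorBit G lab (a * h) (k + 1) v) :
    AnchorBit G lab (a * h) k v := by
  refine hv.of_succ.resolve_right ?_
  rintro ⟨s, -, hs, hs'⟩
  -- a repetition before the anchor would move the anchor closer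
  have hper : ∀ i j, i < j → j ≤ k → s i ≠ s j := by
    intro i j hij hj he
    -- predecessors are unique, so the path is periodic from a repetition on
    have hshift : ∀ t, j + t ≤ k + 1 → s (i + t) = s (j + t) := by
      intro t
      induction t with
      | zero => exact fun _ => he
      | succ t ih =>
        intro ht
        have h1 := (hs (i + t) (by omega)).2
        have h2 := (hs (j + t) (by omega)).2
        rw [ih (by omega)] at h1
        exact h2.unique h1
    have h1 := hshift (k + 1 - j) (by omega)
    rw [show j + (k + 1 - j) = k + 1 by omega] at h1
    exact (hs (i + (k + 1 - j)) (by omega)).1 (h1 ▸ hs')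
  refine absurd hn (not_lt.2 (pow_le_card_of_path s (G := G) (lab := lab) ?_ ?_ ?_))
  · intro i hi j hj he
    rcases lt_trichotomy i j with hij | hij | hij
    · exact absurd he (hper i j hij (by omega))
    · exact hij
    · exact absurd he.symm (hper j i hij (by omega))
  · exact fun i hi => (hs i (by omega)).2
  · exact fun i hi => not_not.1 fun hc => (hs i (by omega)).1 (Or.inl hc)

/-- The output of the algorithm satisfies the constraint everywhere, if `h` is large enough for the
graph. -/
theorem copyOutput_ok [Finite V] {h : ℕ} (hn : Nat.card V < h ^ (p + a)) (v : V) :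
    CopyOk G (fun u => (lab u, copyOutput G lab h u)) v := by
  classical
  have hanchor : ∀ k, Anchor G lab (a * h) v →
      (AnchorBit G lab (a * h) k v ↔ (lab v).bit = true) := by
    rintro (_ | k) hv
    · exact ⟨And.right, fun hb => ⟨hv, hb⟩⟩
    · exact ⟨fun hb => hb.elim And.right fun hb => absurd hv hb.1, fun hb => Or.inl ⟨hv, hb⟩⟩
  have hpos : 0 < h := Nat.pos_of_ne_zero fun h0 => by
    subst h0
    rcases Nat.eq_zero_or_pos (p + a) with hz | hz
    · rw [hz, pow_zero, Nat.lt_one_iff, Finite.card_eq_zero_iff] at hn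
      exact hn.false v
    · rw [zero_pow hz.ne'] at hn
      omega
  refine ⟨fun he => ?_, fun he u hu => ?_, fun hno => ?_⟩
  · have he' : ¬Clean G lab (a * h) v := of_decide_eq_true he
    by_cases hg : Good G lab v
    · refine Or.inr ?_
      cases hd : a * h with
      | zero => rw [hd] at he'; exact absurd hg he'
      | succ d =>
        rw [hd] at he'
        have : ∃ w, LabelAdj G lab ChildRel v w ∧ ¬Clean G lab d w := by
          by_contra hc
          push Not at hc
          exact he' ⟨hg, hc⟩
        obtain ⟨w, hw, hc⟩ := this
        refine ⟨w, hw, ?_⟩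
        refine decide_eq_true fun h' => hc ?_
        rw [hd] at h'
        exact h'.of_succ
    · exact Or.inl hg
  · have he' : Clean G lab (a * h) v := not_not.1 (of_decide_eq_false he)
    have hna : ¬Anchor G lab (a * h) v := by
      rintro (hc | hc)
      · exact hc he'
      · exact hc ⟨u, hu⟩
    obtain ⟨k, hk⟩ : ∃ k, k + 1 = 2 * h ^ p :=
      ⟨2 * h ^ p - 1, by have := Nat.pow_pos (n := p) hpos; omega⟩
    refine decide_eq_decide.2 ?_
    rw [← hk]
    constructor
    · rintro (hb | ⟨-, u', hu', hb⟩)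
      · exact absurd hb.1 hna
      · exact (hu.unique hu' ▸ hb).succ
    · exact fun hb => Or.inr ⟨hna, u, hu, hb.of_succ_of_card_lt hk hn⟩
  · change decide _ = (lab v).bit
    rw [Bool.decide_congr (hanchor _ (Or.inr hno))]
    simp

end Algorithm

/-- The algorithm for `copyLCL` with column length `h n` on graphs with `n` nodes. -/
noncomputable def copyAlgorithm (p a : ℕ) (h : ℕ → ℕ) : LocalAlgorithm (InLabel p a) OutLabel :=
  LocalAlgorithm.ofFun fun n _ G lab v => copyOutput G lab (h n) v

theorem copyLCL_solvedBy (p a Δ c : ℕ) (h : ℕ → ℕ) (hh : ∀ n, n < h n ^ (p + a)) :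
    (copyLCL p a).SolvedBy Δ c (copyAlgorithm p a h) (fun n => 2 * h n ^ p + a * h n + 2) := by
  intro V _ G _ _ ident hid _ (inp : V → InLabel p a)
  refine (LCL.ofLocal_isValid_iff (copyOk_isLocal p a) G inp _).2 fun v => ?_
  have hout : (fun u => copyAlgorithm p a h
      (localView G ident inp (2 * h (Nat.card V) ^ p + a * h (Nat.card V) + 2) u)) =
        copyOutput G inp (h (Nat.card V)) := funext fun u =>
    LocalAlgorithm.ofFun_localView G hid inp _ (copyOutput_isLocal p a _) u
  have := copyOutput_ok (G := G) (lab := inp) (hh (Nat.card V)) v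
  rw [← hout] at this
  exact this

/-! ### Instances on which the bit has to travel far -/

/-- The tree structure on lists of column positions. A list `s :: σ` is cell number `s` of the
column that is carried by the node `σ`. -/
def TreeChild (σ τ : List ℕ) : Prop := τ = 0 :: σ ∨ ∃ s ρ, σ = s :: ρ ∧ τ = (s + 1) :: ρ

theorem TreeChild.unique {σ σ' τ : List ℕ} (h : TreeChild σ τ) (h' : TreeChild σ' τ) :
    σ = σ' := by
  rcases h with rfl | ⟨s, ρ, rfl, rfl⟩ <;> rcases h' with h' | ⟨s', ρ', rfl, h'⟩ <;> simp_all

/-- The depth of a node in the tree. -/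
def treeDepth (σ : List ℕ) : ℕ := σ.sum + σ.length

theorem TreeChild.depth {σ τ : List ℕ} (h : TreeChild σ τ) : treeDepth τ = treeDepth σ + 1 := by
  rcases h with rfl | ⟨s, ρ, rfl, rfl⟩ <;> simp [treeDepth] <;> ring

/-- Potential nodes of the instances: position `x` on the path and a node of the tree, or a padding
node. -/
abbrev Site : Type := (ℕ × List ℕ) ⊕ ℕ

/-- The edges of the instances: copies of a tree are joined along a path, and a padding path hangs
off the first root. -/
def SiteStep : Site → Site → Prop
  | .inl (x, σ), .inl (y, τ) => (y = x + 1 ∧ τ = σ) ∨ (y = x ∧ TreeChild σ τ)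
  | .inl (x, σ), .inr i => x = 0 ∧ σ = [] ∧ i = 0
  | .inr i, .inr j => j = i + 1
  | .inr _, .inl _ => False

/-- `D` copies of the tree with columns of `m` cells and `a` levels above the root, and `k` padding
nodes. -/
def siteSet (D a m k : ℕ) : Set Site :=
  Sum.inl '' (Set.Iio D ×ˢ {σ : List ℕ | σ.length ≤ a ∧ ∀ s ∈ σ, s < m}) ∪ Sum.inr '' Set.Iio k

/-- The graph of the instance. -/
def hardGraph (D a m k : ℕ) : SimpleGraph (siteSet D a m k) :=
  SimpleGraph.fromRel fun u w => SiteStep u w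

/-- The labels of the instance: all columns over position `x` hold the number `x` in base
`m + 1`. -/
def hardLabel (p a m : ℕ) (β : Bool) : Site → InLabel p a
  | .inl (x, σ) =>
    { lvl := ⟨min σ.length (a + 1), by omega⟩
      X := x
      Z := treeDepth σ
      digit := fun j => decide (σ.headD 0 < x / (m + 1) ^ (j : ℕ) % (m + 1))
      carry := fun j => decide ((m + 1) ^ (j : ℕ) ∣ x + 1)
      bit := decide (x = 0) && β }
  | .inr _ =>
    { lvl := ⟨a + 1, by omega⟩
      X := 0
      Z := 0
      digit := fun _ => false
      carry := fun _ => false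
      bit := false }

theorem inl_mem_siteSet {D a m k x : ℕ} {σ : List ℕ} :
    Sum.inl (x, σ) ∈ siteSet D a m k ↔ x < D ∧ σ.length ≤ a ∧ ∀ s ∈ σ, s < m := by
  simp [siteSet]

theorem inr_mem_siteSet {D a m k i : ℕ} : Sum.inr i ∈ siteSet D a m k ↔ i < k := by
  simp [siteSet]

theorem SiteStep.ne {u w : Site} (h : SiteStep u w) : u ≠ w := by
  rintro rfl
  rcases u with ⟨x, σ⟩ | i
  · rcases h with ⟨h, -⟩ | ⟨-, h⟩
    · omega
    · have := h.depth
      omega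
  · have : i = i + 1 := h
    omega

theorem hardGraph_adj {D a m k : ℕ} {u w : siteSet D a m k} :
    (hardGraph D a m k).Adj u w ↔ SiteStep u w ∨ SiteStep w u := by
  rw [hardGraph, SimpleGraph.fromRel_adj]
  refine ⟨And.right, fun h => ⟨fun he => ?_, h⟩⟩
  subst he
  exact h.elim (fun h => h.ne rfl) fun h => h.ne rfl

theorem digit_succ_of_not_dvd {x b m : ℕ} (h : ¬b ∣ x + 1) :
    (x + 1) / b % (m + 1) = x / b % (m + 1) := by
  rw [Nat.succ_div, if_neg h, add_zero]

theorem digit_succ_of_dvd_mul {x b m : ℕ} (hb : 0 < b) (h : b * (m + 1) ∣ x + 1) :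
    x / b % (m + 1) = m ∧ (x + 1) / b % (m + 1) = 0 := by
  obtain ⟨q, hq⟩ := h
  have h1 : (x + 1) / b = (m + 1) * q := by
    rw [hq, mul_assoc, Nat.mul_div_cancel_left _ hb]
  have h2 : (x + 1) / b = x / b + 1 := by
    rw [Nat.succ_div, if_pos ⟨(m + 1) * q, by rw [hq, mul_assoc]⟩]
  refine ⟨?_, by rw [h1, Nat.mul_mod_right]⟩
  rcases q with _ | q
  · omega
  · have h3 : x / b = m + (m + 1) * q := by
      have : (m + 1) * (q + 1) = (m + 1) * q + m + 1 := by ring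
      omega
    rw [h3, Nat.add_mul_mod_self_left, Nat.mod_eq_of_lt (by omega)]

theorem digit_succ_of_dvd {x b m : ℕ} (h : b ∣ x + 1) (h' : ¬b * (m + 1) ∣ x + 1) :
    (x + 1) / b % (m + 1) = x / b % (m + 1) + 1 := by
  have h2 : (x + 1) / b = x / b + 1 := by rw [Nat.succ_div, if_pos h]
  have h3 : ¬(m + 1) ∣ x / b + 1 := by
    rintro ⟨q, hq⟩
    refine h' ⟨q, ?_⟩
    rw [mul_assoc, ← hq, ← h2, Nat.mul_div_cancel' h]
  have h4 := Nat.div_add_mod (x / b) (m + 1)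
  have h5 := Nat.mod_lt (x / b) (show 0 < m + 1 by omega)
  have h6 : x / b % (m + 1) + 1 < m + 1 := by
    refine lt_of_le_of_ne h5 fun he => h3 ⟨x / b / (m + 1) + 1, ?_⟩
    rw [mul_add, mul_one]
    omega
  rw [h2]
  conv_lhs => rw [← h4]
  rw [add_assoc, Nat.mul_add_mod, Nat.mod_eq_of_lt h6]

section HardInstance

variable {p a D m k : ℕ} {β : Bool}

theorem hardLabel_lvl {x : ℕ} {σ : List ℕ} (h : Sum.inl (x, σ) ∈ siteSet D a m k) :
    ((hardLabel p a m β (Sum.inl (x, σ))).lvl : ℕ) = σ.length := by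
  have := (inl_mem_siteSet.1 h).2.1
  simp [hardLabel]
  omega

theorem zmod_three_ne_add_one (z : ZMod 3) : z ≠ z + 1 ∧ z ≠ z + 1 + 1 := by
  revert z
  decide

/-- On the instance, the relations of the problem are the intended ones. -/
theorem hard_xRel_iff {u w : siteSet D a m k} :
    LabelAdj (hardGraph D a m k) (fun v => hardLabel p a m β v) XRel u w ↔
      ∃ x σ, u.1 = Sum.inl (x, σ) ∧ w.1 = Sum.inl (x + 1, σ) := by
  constructor
  · rintro ⟨hadj, hl, hlvl, hX⟩
    rw [hardGraph_adj] at hadj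
    obtain ⟨⟨x, σ⟩ | i, hu⟩ := u
    · obtain ⟨⟨y, τ⟩ | j, hw⟩ := w
      · simp only [hardLabel] at hX
        rcases hadj with (⟨rfl, rfl⟩ | ⟨rfl, -⟩) | (⟨rfl, rfl⟩ | ⟨rfl, -⟩)
        · exact ⟨x, τ, rfl, rfl⟩
        · exact absurd hX (zmod_three_ne_add_one _).1
        · push_cast at hX
          exact absurd hX (zmod_three_ne_add_one _).2
        · exact absurd hX (zmod_three_ne_add_one _).1
      · have h1 : ((hardLabel p a m β (Sum.inr j)).lvl : ℕ) = a + 1 := rfl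
        rw [← hlvl] at h1
        omega
    · have : a + 1 ≤ a := hl
      omega
  · obtain ⟨u, hu⟩ := u
    obtain ⟨w, hw⟩ := w
    rintro ⟨x, σ, rfl, rfl⟩
    refine ⟨hardGraph_adj.2 (Or.inl (Or.inl ⟨rfl, rfl⟩)), ?_, rfl, ?_⟩
    · rw [hardLabel_lvl hu]
      exact (inl_mem_siteSet.1 hu).2.1
    · simp [hardLabel]

theorem hard_child_iff {u w : siteSet D a m k} :
    LabelAdj (hardGraph D a m k) (fun v => hardLabel p a m β v) ChildRel u w ↔
      ∃ x σ τ, u.1 = Sum.inl (x, σ) ∧ w.1 = Sum.inl (x, τ) ∧ TreeChild σ τ := by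
  constructor
  · rintro ⟨hadj, hch⟩
    rw [hardGraph_adj] at hadj
    have hlvl : ((hardLabel p a m β u).lvl : ℕ) ≤ a ∧ ((hardLabel p a m β w).lvl : ℕ) ≤ a := by
      rcases hch with ⟨-, h1, h2, -⟩ | ⟨h1, h2, -⟩
      · exact ⟨h1, h2 ▸ h1⟩
      · beta_reduce at h1 h2
        exact ⟨by omega, h2⟩
    have hX : (hardLabel p a m β w).X = (hardLabel p a m β u).X := by
      rcases hch with h | h
      · exact h.2.2.2.1
      · exact h.2.2.1
    have hZ : (hardLabel p a m β w).Z = (hardLabel p a m β u).Z + 1 := by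
      rcases hch with h | h
      · exact h.2.2.2.2
      · exact h.2.2.2
    obtain ⟨⟨x, σ⟩ | i, hu⟩ := u
    · obtain ⟨⟨y, τ⟩ | j, hw⟩ := w
      · simp only [hardLabel] at hX hZ
        rcases hadj with (⟨rfl, rfl⟩ | ⟨rfl, h⟩) | (⟨rfl, rfl⟩ | ⟨rfl, h⟩)
        · push_cast at hX
          exact absurd hX.symm (zmod_three_ne_add_one _).1
        · exact ⟨y, σ, τ, rfl, rfl, h⟩
        · push_cast at hX
          exact absurd hX (zmod_three_ne_add_one _).1
        · rw [h.depth] at hZ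
          push_cast at hZ
          exact absurd hZ (zmod_three_ne_add_one _).2
      · have : a + 1 ≤ a := hlvl.2
        omega
    · have : a + 1 ≤ a := hlvl.1
      omega
  · obtain ⟨u, hu⟩ := u
    obtain ⟨w, hw⟩ := w
    rintro ⟨x, σ, τ, rfl, rfl, h⟩
    refine ⟨hardGraph_adj.2 (Or.inl (Or.inr ⟨rfl, h⟩)), ?_⟩
    have hZ : (hardLabel p a m β (Sum.inl (x, τ))).Z =
        (hardLabel p a m β (Sum.inl (x, σ))).Z + 1 := by
      simp [hardLabel, h.depth]
    have h1 := hardLabel_lvl (p := p) (β := β) hu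
    have h2 := hardLabel_lvl (p := p) (β := β) hw
    have h3 := (inl_mem_siteSet.1 hw).2.1
    rcases h with rfl | ⟨s, ρ, rfl, rfl⟩
    · refine Or.inr ⟨?_, h2.trans_le h3, rfl, hZ⟩
      rw [h1, h2, List.length_cons]
    · refine Or.inl ⟨?_, ?_, Fin.ext ?_, rfl, hZ⟩ <;> simp_all

theorem hard_next_iff {u w : siteSet D a m k} :
    LabelAdj (hardGraph D a m k) (fun v => hardLabel p a m β v) NextRel u w ↔
      ∃ x s ρ, u.1 = Sum.inl (x, s :: ρ) ∧ w.1 = Sum.inl (x, (s + 1) :: ρ) := by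
  constructor
  · intro h
    obtain ⟨x, σ, τ, hu, hw, hch⟩ := hard_child_iff.1 ⟨h.1, Or.inl h.2⟩
    have h1 := h.2.2.2.1
    have h2 := hardLabel_lvl (p := p) (β := β) (hu ▸ u.2)
    have h3 := hardLabel_lvl (p := p) (β := β) (hw ▸ w.2)
    rw [← hu] at h2
    rw [← hw] at h3
    rcases hch with rfl | ⟨s, ρ, rfl, rfl⟩
    · beta_reduce at h1
      rw [List.length_cons, ← h1] at h3
      omega
    · exact ⟨x, s, ρ, hu, hw⟩
  · rintro ⟨x, s, ρ, hu, hw⟩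
    have h := (hard_child_iff (p := p) (β := β)).2
      ⟨x, _, _, hu, hw, Or.inr ⟨s, ρ, rfl, rfl⟩⟩
    refine ⟨h.1, h.2.next (Fin.ext ?_)⟩
    have h2 := hardLabel_lvl (p := p) (β := β) (hu ▸ u.2)
    have h3 := hardLabel_lvl (p := p) (β := β) (hw ▸ w.2)
    rw [← hu] at h2
    rw [← hw] at h3
    rw [h2, h3]
    rfl

theorem hard_branch_iff {u w : siteSet D a m k} :
    LabelAdj (hardGraph D a m k) (fun v => hardLabel p a m β v) BranchRel u w ↔
      ∃ x σ, u.1 = Sum.inl (x, σ) ∧ w.1 = Sum.inl (x, 0 :: σ) := by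
  constructor
  · intro h
    obtain ⟨x, σ, τ, hu, hw, hch⟩ := hard_child_iff.1 ⟨h.1, Or.inr h.2⟩
    have h1 := h.2.1
    have h2 := hardLabel_lvl (p := p) (β := β) (hu ▸ u.2)
    have h3 := hardLabel_lvl (p := p) (β := β) (hw ▸ w.2)
    rw [← hu] at h2
    rw [← hw] at h3
    rcases hch with rfl | ⟨s, ρ, rfl, rfl⟩
    · exact ⟨x, σ, hu, hw⟩
    · beta_reduce at h1
      rw [List.length_cons] at h2 h3
      omega
  · rintro ⟨x, σ, hu, hw⟩
    have h := (hard_child_iff (p := p) (β := β)).2 ⟨x, _, _, hu, hw, Or.inl rfl⟩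
    refine ⟨h.1, h.2.branch ?_⟩
    have h2 := hardLabel_lvl (p := p) (β := β) (hu ▸ u.2)
    have h3 := hardLabel_lvl (p := p) (β := β) (hw ▸ w.2)
    rw [← hu] at h2
    rw [← hw] at h3
    rw [h2, h3]
    rfl

theorem hard_counterStep {x : ℕ} {σ τ : List ℕ}
    (hσ : Sum.inl (x, σ) ∈ siteSet D a m k) (hτ : Sum.inl (x, τ) ∈ siteSet D a m k)
    (h : TreeChild σ τ) :
    CounterStep (hardLabel p a m β (Sum.inl (x, σ))) (hardLabel p a m β (Sum.inl (x, τ)))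
      (hardLabel p a m β (Sum.inl (x + 1, τ))) := by
  have hb : ∀ j, 0 < (m + 1) ^ j := fun j => by positivity
  intro j
  have h1 := hardLabel_lvl (p := p) (β := β) hσ
  have h2 := hardLabel_lvl (p := p) (β := β) hτ
  refine ⟨fun hc => ?_, fun hc => ?_, fun hc hc' hn => ?_, fun hc hc' hbr => ?_⟩ <;>
    simp only [hardLabel, Fin.val_castSucc, Fin.val_succ, decide_eq_true_eq,
      decide_eq_false_iff_not, pow_succ] at hc ⊢
  · rw [digit_succ_of_not_dvd hc]
  · rw [(digit_succ_of_dvd_mul (hb j) hc).2]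
    omega
  · simp only [hardLabel, Fin.val_succ, decide_eq_false_iff_not, pow_succ] at hc'
    rw [digit_succ_of_dvd hc hc']
    rcases h with rfl | ⟨s, ρ, rfl, rfl⟩
    · have := congrArg Fin.val hn.2.2.1
      rw [h1, h2, List.length_cons] at this
      omega
    · simp
  · simp only [hardLabel, Fin.val_succ, decide_eq_false_iff_not, pow_succ] at hc'
    rw [digit_succ_of_dvd hc hc']
    rcases h with rfl | ⟨s, ρ, rfl, rfl⟩
    · simp
    · have := hbr.1
      rw [h1, h2, List.length_cons, List.length_cons] at this
      omega

/-- All nodes other than the padding nodes are correct. -/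
theorem hard_good (hm : 0 < m) (hD : D < (m + 1) ^ p) {x : ℕ} {σ : List ℕ}
    (hv : Sum.inl (x, σ) ∈ siteSet D a m k) :
    Good (hardGraph D a m k) (fun v => hardLabel p a m β v) ⟨Sum.inl (x, σ), hv⟩ := by
  have hb : ∀ j, 0 < (m + 1) ^ j := fun j => by positivity
  obtain ⟨hxD, hlen, hs⟩ := inl_mem_siteSet.1 hv
  have hpar : ∀ u, LabelAdj (hardGraph D a m k) (fun v => hardLabel p a m β v) (flip ChildRel)
      ⟨Sum.inl (x, σ), hv⟩ u → ∃ τ, u.1 = Sum.inl (x, τ) ∧ TreeChild τ σ := by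
    intro u hu
    obtain ⟨y, τ, σ', h1, h2, h3⟩ := hard_child_iff.1 ⟨hu.1.symm, hu.2⟩
    obtain ⟨rfl, rfl⟩ : x = y ∧ σ = σ' := by simpa using h2
    exact ⟨τ, h1, h3⟩
  refine ⟨?_, ?_, ?_, ?_, ?_, ?_⟩
  · intro u hu u' hu'
    obtain ⟨τ, h1, h2⟩ := hpar u hu
    obtain ⟨τ', h1', h2'⟩ := hpar u' hu'
    exact Subtype.ext (by rw [h1, h1', h2.unique h2'])
  · intro hl
    rw [hardLabel_lvl hv] at hl
    have hmem : Sum.inl (x, 0 :: σ) ∈ siteSet D a m k := by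
      refine inl_mem_siteSet.2 ⟨hxD, hl, fun s hs' => ?_⟩
      rcases List.mem_cons.1 hs' with rfl | hs'
      · exact hm
      · exact hs s hs'
    exact ⟨⟨_, hmem⟩, hard_branch_iff.2 ⟨x, σ, rfl, rfl⟩⟩
  · intro w hw v' hv'
    obtain ⟨y, σ', τ, h1, h2, h3⟩ := hard_child_iff.1 hw
    obtain ⟨rfl, rfl⟩ : x = y ∧ σ = σ' := by simpa using h1
    obtain ⟨y, σ', h1', h2'⟩ := hard_xRel_iff.1 hv'
    obtain ⟨rfl, rfl⟩ : x = y ∧ σ = σ' := by simpa using h1'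
    obtain ⟨w, hwm⟩ := w
    obtain ⟨v', hvm⟩ := v'
    obtain rfl : w = _ := h2
    obtain rfl : v' = _ := h2'
    have hmem : Sum.inl (x + 1, τ) ∈ siteSet D a m k :=
      inl_mem_siteSet.2 ⟨(inl_mem_siteSet.1 hvm).1, (inl_mem_siteSet.1 hwm).2⟩
    exact ⟨⟨_, hmem⟩, hard_xRel_iff.2 ⟨x, τ, rfl, rfl⟩,
      hard_child_iff.2 ⟨x + 1, σ, τ, rfl, rfl, h3⟩, hard_counterStep hv hwm h3⟩
  · intro w hw
    obtain ⟨y, s, ρ, h1, h2⟩ := hard_next_iff.1 hw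
    obtain ⟨rfl, rfl⟩ : x = y ∧ σ = s :: ρ := by simpa using h1
    beta_reduce
    rw [h2]
    rfl
  · intro hl
    rw [hardLabel_lvl hv] at hl
    refine ⟨by simp [hardLabel], ?_, fun j hc => ?_⟩
    · simp only [hardLabel, Fin.val_last, decide_eq_false_iff_not]
      intro hdvd
      have := Nat.le_of_dvd (by omega) hdvd
      omega
    · simp only [hardLabel, Fin.val_succ, Fin.val_castSucc, decide_eq_true_eq, pow_succ] at hc ⊢
      refine ⟨(dvd_mul_right _ _).trans hc, ?_⟩
      rw [(digit_succ_of_dvd_mul (hb j) hc).1]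
      cases σ with
      | nil => simp at hl
      | cons s ρ => exact hs s (by simp)
  · intro hl hno
    rw [hardLabel_lvl hv] at hl
    cases σ with
    | nil => simp at hl
    | cons s ρ =>
      have htop : ¬s + 1 < m := by
        intro hsm
        have hmem : Sum.inl (x, (s + 1) :: ρ) ∈ siteSet D a m k := by
          refine inl_mem_siteSet.2 ⟨hxD, hlen, fun s' hs' => ?_⟩
          rcases List.mem_cons.1 hs' with rfl | hs'
          · exact hsm
          · exact hs s' (by simp [hs'])
        exact hno ⟨⟨_, hmem⟩, hard_next_iff.2 ⟨x, s, ρ, rfl, rfl⟩⟩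
      constructor
      · intro j hc hc'
        simp only [hardLabel, Fin.val_succ, Fin.val_castSucc, decide_eq_true_eq,
          decide_eq_false_iff_not, pow_succ] at hc hc'
        have h1 := digit_succ_of_dvd hc hc'
        have h2 := Nat.mod_lt ((x + 1) / (m + 1) ^ (j : ℕ)) (show 0 < m + 1 by omega)
        rw [h1] at h2
        refine decide_eq_false ?_
        change ¬s < x / (m + 1) ^ (j : ℕ) % (m + 1)
        omega
      · rintro v' hv' ⟨w', hw'⟩
        obtain ⟨y, σ', h1', h2'⟩ := hard_xRel_iff.1 hv'
        obtain ⟨rfl, rfl⟩ : x = y ∧ s :: ρ = σ' := by simpa using h1'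
        obtain ⟨y, s', ρ', h1, h2⟩ := hard_next_iff.1 hw'
        rw [h2'] at h1
        obtain ⟨rfl, rfl, rfl⟩ : x + 1 = y ∧ s = s' ∧ ρ = ρ' := by simpa using h1
        exact htop ((inl_mem_siteSet.1 (h2 ▸ w'.2)).2.2 (s + 1) (by simp))

instance siteSet_finite : Finite (siteSet D a m k) := by
  have h1 : {σ : List ℕ | σ.length ≤ a ∧ ∀ s ∈ σ, s < m}.Finite := by
    refine ((List.finite_length_le (Fin m) a).image (List.map Fin.val)).subset ?_
    rintro σ ⟨h1, h2⟩
    exact ⟨σ.pmap (fun s h => (⟨s, h⟩ : Fin m)) h2, by simpa using h1, by simp [List.map_pmap]⟩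
  exact (((Set.finite_Iio D).prod h1).image _).union ((Set.finite_Iio k).image _)

/-- In a valid output for the instance, all roots have the bit of the first root. -/
theorem hard_bit_eq (hm : 0 < m) (hD : D < (m + 1) ^ p) {out : siteSet D a m k → OutLabel}
    (hok : ∀ v, CopyOk (hardGraph D a m k) (fun u => (hardLabel p a m β u, out u)) v) {x : ℕ}
    (hx : Sum.inl (x, []) ∈ siteSet D a m k) : (out ⟨_, hx⟩).bit = β := by
  have herr : ∀ x σ (hv : Sum.inl (x, σ) ∈ siteSet D a m k), (out ⟨_, hv⟩).err = false := by
    by_contra hcon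
    push Not at hcon
    obtain ⟨x, σ, hv, he⟩ := hcon
    -- consider a reported error of maximal depth
    let depth : siteSet D a m k → ℕ := fun u => Sum.elim (fun q => treeDepth q.2) (fun _ => 0) u.1
    obtain ⟨⟨u, hu⟩, ⟨⟨y, τ, rfl⟩, hue⟩, hmax⟩ := Set.exists_max_image
      {u : siteSet D a m k | (∃ x σ, u.1 = Sum.inl (x, σ)) ∧ (out u).err = true} depth
      (Set.toFinite _) ⟨⟨_, hv⟩, ⟨x, σ, rfl⟩, by simpa using he⟩
    rcases (hok ⟨_, hu⟩).1 hue with h | ⟨w, hw, hwe⟩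
    · exact h (hard_good hm hD hu)
    · obtain ⟨y', τ', ρ, h1, h2, h3⟩ := hard_child_iff.1 hw
      have h4 := hmax w ⟨⟨_, _, h2⟩, hwe⟩
      obtain ⟨rfl, rfl⟩ : y = y' ∧ τ = τ' := by simpa using h1
      have h5 := h3.depth
      simp only [depth, h2, Sum.elim_inl] at h4
      omega
  induction x with
  | zero =>
    have := (hok ⟨_, hx⟩).2.2 (by
      rintro ⟨u, hu⟩
      obtain ⟨y, σ, -, h⟩ := hard_xRel_iff.1 hu.1
      simp at h)
    simpa [hardLabel] using this
  | succ x ih =>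
    have hx' : Sum.inl (x, []) ∈ siteSet D a m k := by
      have := inl_mem_siteSet.1 hx
      exact inl_mem_siteSet.2 ⟨by omega, this.2⟩
    rw [← ih hx']
    refine (hok ⟨_, hx⟩).2.1 (herr _ _ hx) ⟨_, hx'⟩ ⟨hard_xRel_iff.2 ⟨x, [], rfl, rfl⟩, ?_, ?_, ?_⟩
    · exact hardLabel_lvl hx
    · intro u' hu'
      obtain ⟨y, σ, h1, h2⟩ := hard_xRel_iff.1 ⟨hu'.1.symm, hu'.2⟩
      obtain ⟨rfl, rfl⟩ : x = y ∧ [] = σ := by simpa using h2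
      exact Subtype.ext h1
    · intro v' hv'
      obtain ⟨y, σ, h1, h2⟩ := hard_xRel_iff.1 hv'
      obtain ⟨rfl, rfl⟩ : x = y ∧ [] = σ := by simpa using h1
      exact Subtype.ext h2

end HardInstance

section HardGraph

variable {a D m k : ℕ}

theorem hardGraph_connected (hD : 0 < D) : (hardGraph D a m k).Connected := by
  have hroot : Sum.inl (0, []) ∈ siteSet D a m k := inl_mem_siteSet.2 ⟨hD, by simp, by simp⟩
  have hstep : ∀ {u w : Site} (hu : u ∈ siteSet D a m k) (hw : w ∈ siteSet D a m k),
      SiteStep u w → (hardGraph D a m k).Reachable ⟨u, hu⟩ ⟨w, hw⟩ := fun hu hw h =>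
    SimpleGraph.Adj.reachable (hardGraph_adj.2 (Or.inl h))
  have hmain : ∀ x, ∀ hx : Sum.inl (x, []) ∈ siteSet D a m k,
      (hardGraph D a m k).Reachable ⟨_, hroot⟩ ⟨_, hx⟩ := by
    intro x
    induction x with
    | zero => exact fun _ => SimpleGraph.Reachable.refl _
    | succ x ih =>
      intro hx
      have hx' : Sum.inl (x, []) ∈ siteSet D a m k :=
        inl_mem_siteSet.2 ⟨by have := (inl_mem_siteSet.1 hx).1; omega, by simp, by simp⟩
      exact (ih hx').trans (hstep hx' hx (Or.inl ⟨rfl, rfl⟩))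
  have htree : ∀ x σ, ∀ hx : Sum.inl (x, σ) ∈ siteSet D a m k,
      (hardGraph D a m k).Reachable ⟨_, hroot⟩ ⟨_, hx⟩ := by
    intro x σ
    induction σ with
    | nil => exact hmain x
    | cons s ρ ih =>
      induction s with
      | zero =>
        intro hx
        have hx0 := inl_mem_siteSet.1 hx
        have hx' : Sum.inl (x, ρ) ∈ siteSet D a m k :=
          inl_mem_siteSet.2 ⟨hx0.1, by have := hx0.2.1; simp at this; omega,
            fun s hs => hx0.2.2 s (by simp [hs])⟩
        exact (ih hx').trans (hstep hx' hx (Or.inr ⟨rfl, Or.inl rfl⟩))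
      | succ s ihs =>
        intro hx
        have hx0 := inl_mem_siteSet.1 hx
        have hx' : Sum.inl (x, s :: ρ) ∈ siteSet D a m k := by
          refine inl_mem_siteSet.2 ⟨hx0.1, hx0.2.1, fun s' hs => ?_⟩
          rcases List.mem_cons.1 hs with rfl | hs
          · have := hx0.2.2 (s' + 1) (by simp)
            omega
          · exact hx0.2.2 s' (by simp [hs])
        exact (ihs hx').trans (hstep hx' hx (Or.inr ⟨rfl, Or.inr ⟨s, ρ, rfl, rfl⟩⟩))
  have hpad : ∀ i, ∀ hi : Sum.inr i ∈ siteSet D a m k,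
      (hardGraph D a m k).Reachable ⟨_, hroot⟩ ⟨_, hi⟩ := by
    intro i
    induction i with
    | zero => exact fun hi => hstep hroot hi ⟨rfl, rfl, rfl⟩
    | succ i ih =>
      intro hi
      have hi' : Sum.inr i ∈ siteSet D a m k :=
        inr_mem_siteSet.2 (by have := inr_mem_siteSet.1 hi; omega)
      exact (ih hi').trans (hstep hi' hi rfl)
  refine (SimpleGraph.connected_iff_exists_forall_reachable _).2 ⟨⟨_, hroot⟩, ?_⟩
  rintro ⟨⟨x, σ⟩ | i, hu⟩
  · exact htree x σ hu
  · exact hpad i hu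

/-- A node is adjacent to at most its copies at the two neighbouring positions, its parent, two
children, and a padding node. -/
theorem hardGraph_degree_le (v : siteSet D a m k) : nodeDegree (hardGraph D a m k) v ≤ 6 := by
  classical
  have key : ∃ s : Finset Site, s.card ≤ 6 ∧ ∀ w, (hardGraph D a m k).Adj v w → w.1 ∈ s := by
    obtain ⟨⟨x, σ⟩ | i, hv⟩ := v
    · refine ⟨{.inl (x + 1, σ), .inl (x - 1, σ), .inl (x, 0 :: σ),
        .inl (x, (σ.headD 0 + 1) :: σ.tail),
        .inl (x, if σ.headD 0 = 0 then σ.tail else (σ.headD 0 - 1) :: σ.tail), .inr 0},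
        Finset.card_le_six, ?_⟩
      rintro ⟨⟨y, τ⟩ | j, hw⟩ hadj
      · rcases hardGraph_adj.1 hadj with (⟨rfl, rfl⟩ | ⟨rfl, h⟩) | (⟨rfl, rfl⟩ | ⟨rfl, h⟩)
        · simp
        · rcases h with rfl | ⟨s, ρ, rfl, rfl⟩ <;> simp
        · simp
        · rcases h with rfl | ⟨s, ρ, rfl, rfl⟩ <;> simp
      · rcases hardGraph_adj.1 hadj with ⟨-, -, rfl⟩ | h
        · simp
        · exact h.elim
    · refine ⟨{.inr (i + 1), .inr (i - 1), .inl (0, [])},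
        Finset.card_le_three.trans (by omega), ?_⟩
      rintro ⟨⟨y, τ⟩ | j, hw⟩ hadj
      · rcases hardGraph_adj.1 hadj with h | ⟨rfl, rfl, -⟩
        · exact h.elim
        · simp
      · rcases hardGraph_adj.1 hadj with h | h
        · obtain rfl : j = i + 1 := h
          simp
        · obtain rfl : i = j + 1 := h
          simp
  obtain ⟨s, hs, hsub⟩ := key
  have h1 : ((↑) '' (hardGraph D a m k).neighborSet v : Set Site) ⊆ s := by
    rintro _ ⟨w, hw, rfl⟩
    exact hsub w hw
  have h2 := Set.ncard_le_ncard h1 s.finite_toSet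
  rw [Set.ncard_image_of_injective _ Subtype.val_injective, Set.ncard_coe_finset] at h2
  exact h2.trans hs

theorem ncard_tree_le (hm : 0 < m) :
    {σ : List ℕ | σ.length ≤ a ∧ ∀ s ∈ σ, s < m}.ncard ≤ (a + 1) * m ^ a := by
  have := Nat.card_le_card_of_injective
    (fun σ : {σ : List ℕ | σ.length ≤ a ∧ ∀ s ∈ σ, s < m} =>
      ((⟨σ.1.length, by have := σ.2.1; omega⟩, fun i => ⟨σ.1.getD i 0, by
        by_cases hi : (i : ℕ) < σ.1.length
        · rw [List.getD_eq_getElem _ _ hi]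
          exact σ.2.2 _ (List.getElem_mem hi)
        · rwa [List.getD_eq_default _ _ (not_lt.1 hi)]⟩) : Fin (a + 1) × (Fin a → Fin m))) (by
      rintro ⟨σ, hσ⟩ ⟨τ, hτ⟩ h
      simp only [Prod.mk.injEq, Fin.mk.injEq] at h
      refine Subtype.ext (List.ext_getElem h.1 fun i hi hi' => ?_)
      have := congrArg Fin.val (congrFun h.2 ⟨i, hi.trans_le hσ.1⟩)
      simpa [hi, hi'] using this)
  simpa using this

theorem card_siteSet : Nat.card (siteSet D a m k) =
    D * {σ : List ℕ | σ.length ≤ a ∧ ∀ s ∈ σ, s < m}.ncard + k := by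
  have hfin : (siteSet D a m k).Finite := Set.toFinite _
  rw [Nat.card_coe_set_eq]
  unfold siteSet at hfin ⊢
  rw [Set.ncard_union_eq _ (hfin.subset Set.subset_union_left)
    (hfin.subset Set.subset_union_right), Set.ncard_image_of_injective _ Sum.inl_injective,
    Set.ncard_image_of_injective _ Sum.inr_injective, Set.ncard_prod]
  · simp
  · rw [Set.disjoint_left]
    rintro _ ⟨_, -, rfl⟩ ⟨_, -, h⟩
    simp at h

/-- The position of a node along the path. -/
def sitePos : Site → ℕ
  | .inl (x, _) => x
  | .inr _ => 0

theorem SiteStep.pos_le {u w : Site} (h : SiteStep u w) :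
    sitePos u ≤ sitePos w + 1 ∧ sitePos w ≤ sitePos u + 1 := by
  rcases u with ⟨x, σ⟩ | i <;> rcases w with ⟨y, τ⟩ | j
  · rcases h with ⟨rfl, -⟩ | ⟨rfl, -⟩ <;> simp only [sitePos] <;> omega
  · obtain ⟨rfl, -⟩ := h
    simp [sitePos]
  · exact h.elim
  · simp [sitePos]

theorem sitePos_le_of_edist_le {u w : siteSet D a m k} {t : ℕ}
    (h : (hardGraph D a m k).edist u w ≤ (t : ℕ∞)) : sitePos u ≤ sitePos w + t := by
  obtain ⟨q, hq⟩ := SimpleGraph.exists_walk_of_edist_ne_top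
    (ne_top_of_le_ne_top (ENat.natCast_ne_top t) h)
  rw [← hq] at h
  have hqt : q.length ≤ t := by exact_mod_cast h
  refine le_trans ?_ (Nat.add_le_add_left hqt _)
  clear hq h hqt
  induction q with
  | nil => simp
  | cons hadj q ih =>
    rw [SimpleGraph.Walk.length_cons]
    rcases hardGraph_adj.1 hadj with h | h
    · have := h.pos_le.1
      omega
    · have := h.pos_le.2
      omega

end HardGraph

/-- The lower bound: within fewer than `m ^ p - 1` rounds the last root of the instance does not
see the first one, whose bit it has to output. -/
theorem pow_le_of_solvedBy {p a m c n : ℕ} (hp : 0 < p) (hm : 0 < m) (hc : 1 ≤ c)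
    (hn : m ^ p * ((a + 1) * m ^ a) ≤ n)
    {A : LocalAlgorithm (InLabel p a) OutLabel} {t : ℕ → ℕ}
    (h : (copyLCL p a).SolvedBy 6 c A t) : m ^ p ≤ t n + 1 := by
  by_contra hlt
  push Not at hlt
  obtain ⟨k, hk⟩ : ∃ k, Nat.card (siteSet (m ^ p) a m k) = n := by
    have := Nat.mul_le_mul_left (m ^ p) (ncard_tree_le (a := a) hm)
    refine ⟨n - m ^ p * {σ : List ℕ | σ.length ≤ a ∧ ∀ s ∈ σ, s < m}.ncard, ?_⟩
    rw [card_siteSet]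
    omega
  -- `m ^ p` positions do not exhaust a counter in base `m + 1`
  have hD : m ^ p < (m + 1) ^ p := Nat.pow_lt_pow_left (by omega) (by omega)
  have hlast : Sum.inl (m ^ p - 1, []) ∈ siteSet (m ^ p) a m k :=
    inl_mem_siteSet.2 ⟨by omega, by simp, by simp⟩
  obtain ⟨ident, hid, hbd⟩ := exists_identifiers (siteSet (m ^ p) a m k) hc
  have hbit : ∀ β : Bool, OutLabel.bit (A (localView (hardGraph (m ^ p) a m k) ident
      (fun u => hardLabel p a m β u) (t n) ⟨_, hlast⟩)) = β := by
    intro β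
    have hv := h _ (hardGraph (m ^ p) a m k) (hardGraph_connected (by omega))
      hardGraph_degree_le ident hid hbd (fun u => hardLabel p a m β u)
    rw [hk] at hv
    exact hard_bit_eq hm hD ((LCL.ofLocal_isValid_iff (copyOk_isLocal p a) _ _ _).1 hv) hlast
  have hview : localView (hardGraph (m ^ p) a m k) ident
      (fun u => hardLabel p a m true u) (t n) ⟨_, hlast⟩ =
      localView (hardGraph (m ^ p) a m k) ident
      (fun u => hardLabel p a m false u) (t n) ⟨_, hlast⟩ := by
    refine localView_congr _ _ _ _ fun u hu => ?_
    have hpos := sitePos_le_of_edist_le hu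
    obtain ⟨⟨x, σ⟩ | i, hu'⟩ := u
    · simp only [sitePos] at hpos
      have hx : x ≠ 0 := by omega
      simp [hardLabel, hx]
    · rfl
  have heq := congrArg (fun L => OutLabel.bit (A L)) hview
  exact absurd ((hbit true).symm.trans (heq.trans (hbit false))) (by decide)

/-! ### Exponent zero -/

/-- The problem with constant complexity: is there a marked neighbour? -/
def neighbourLCL : LCL :=
  LCL.ofLocal Bool Bool 1 (fun _ G io v => (io v).2 = true ↔ ∃ w, G.Adj v w ∧ (io w).1 = true)

theorem exists_neighbour_iff {V W σ : Type} {G : SimpleGraph V} {lab : V → σ} {H : SimpleGraph W}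
    {lab' : W → σ} {φ : V → W} {v : V} (h : AgreeUpTo G lab H lab' φ 1 v) (P : σ → Prop) :
    (∃ w', H.Adj (φ v) w' ∧ P (lab' w')) ↔ ∃ w, G.Adj v w ∧ P (lab w) := by
  constructor
  · rintro ⟨w', hw', hP⟩
    obtain ⟨w, hw, rfl⟩ := (h.2.1 w').1 hw'
    exact ⟨w, hw, (h.adj hw).label_eq ▸ hP⟩
  · rintro ⟨w, hw, hP⟩
    exact ⟨φ w, (h.2.1 _).2 ⟨w, hw, rfl⟩, (h.adj hw).label_eq.symm ▸ hP⟩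

theorem neighbour_isLocal : IsLocalFun 1 (fun V (G : SimpleGraph V) (io : V → Bool × Bool) v =>
    (io v).2 = true ↔ ∃ w, G.Adj v w ∧ (io w).1 = true) := by
  intro V W G io H io' φ _ v h
  refine propext ?_
  beta_reduce
  rw [h.label_eq, exists_neighbour_iff h (fun l => l.1 = true)]

/-- The one-round algorithm for `neighbourLCL`. -/
noncomputable def neighbourAlgorithm : LocalAlgorithm Bool Bool :=
  open Classical in
  LocalAlgorithm.ofFun fun _ _ G lab v => decide (∃ w, G.Adj v w ∧ lab w = true)

theorem neighbourLCL_solvedBy (Δ c : ℕ) :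
    neighbourLCL.SolvedBy Δ c neighbourAlgorithm (fun _ => 1) := by
  classical
  intro V _ G _ _ ident hid _ (inp : V → Bool)
  refine (LCL.ofLocal_isValid_iff neighbour_isLocal G inp _).2 fun v => ?_
  have hout : neighbourAlgorithm (localView G ident inp 1 v) =
      decide (∃ w, G.Adj v w ∧ inp w = true) := by
    refine LocalAlgorithm.ofFun_localView G hid inp 1 ?_ v
    intro V W G lab H lab' φ _ v h
    exact decide_eq_decide.2 (exists_neighbour_iff h (fun l => l = true))
  change neighbourAlgorithm (localView G ident inp 1 v) = true ↔ _
  rw [hout, decide_eq_true_eq]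

theorem one_le_of_neighbourLCL_solvedBy {c n : ℕ} (hc : 1 ≤ c) (hn : 2 ≤ n)
    {A : LocalAlgorithm Bool Bool} {t : ℕ → ℕ}
    (h : neighbourLCL.SolvedBy 6 c A t) : 1 ≤ t n := by
  classical
  by_contra hlt
  obtain ⟨k, hk⟩ : ∃ k, Nat.card (siteSet 1 0 1 k) = n := by
    have := ncard_tree_le (a := 0) (m := 1) one_pos
    refine ⟨n - 1 * {σ : List ℕ | σ.length ≤ 0 ∧ ∀ s ∈ σ, s < 1}.ncard, ?_⟩
    rw [card_siteSet]
    simp only [zero_add, one_pow, mul_one] at this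
    omega
  have ht : t n = 0 := by omega
  have hconn := hardGraph_connected (D := 1) (a := 0) (m := 1) (k := k) one_pos
  have : Nontrivial (siteSet 1 0 1 k) := Finite.one_lt_card_iff_nontrivial.1 (by omega)
  obtain ⟨v⟩ := hconn.nonempty
  obtain ⟨w, hw⟩ := hconn.preconnected.exists_adj_of_nontrivial v
  obtain ⟨ident, hid, hbd⟩ := exists_identifiers (siteSet 1 0 1 k) hc
  have hval : ∀ inp : siteSet 1 0 1 k → Bool,
      (A (localView (hardGraph 1 0 1 k) ident inp 0 v) = true ↔
        ∃ w, (hardGraph 1 0 1 k).Adj v w ∧ inp w = true) := by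
    intro inp
    have hv := h _ (hardGraph 1 0 1 k) hconn hardGraph_degree_le ident hid hbd inp
    rw [hk, ht] at hv
    exact (LCL.ofLocal_isValid_iff neighbour_isLocal _ _ _).1 hv v
  have hview : localView (hardGraph 1 0 1 k) ident (fun u => decide (u = w)) 0 v =
      localView (hardGraph 1 0 1 k) ident (fun _ => false) 0 v := by
    refine localView_congr _ _ _ _ fun u hu => ?_
    have : v = u := by simpa using hu
    subst this
    simpa using hw.ne
  have h1 := (hval fun u => decide (u = w)).2 ⟨w, hw, by simp⟩
  have h2 := hval fun _ => false
  rw [hview] at h1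
  simpa using h2.1 h1

/-! ### Asymptotics -/

theorem exists_nat_root {q : ℕ} (hq : 0 < q) (n : ℕ) : ∃ r, r ^ q ≤ n ∧ n < (r + 1) ^ q := by
  have hex : ∃ r, n < (r + 1) ^ q := ⟨n, n.lt_succ_self.trans_le (Nat.le_self_pow hq.ne' _)⟩
  refine ⟨Nat.find hex, ?_, Nat.find_spec hex⟩
  cases hr : Nat.find hex with
  | zero => simp [hq.ne']
  | succ r => exact not_lt.1 (Nat.find_min hex (by omega))

theorem copyLCL_complexity {p : ℕ} (a : ℕ) (hp : 0 < p) {c : ℕ} (hc : 1 ≤ c) :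
    ∃ t : ℕ → ℕ, (copyLCL p a).HasTimeComplexity 6 c t ∧
      (fun n : ℕ => (t n : ℝ)) =Θ[atTop] (fun n : ℕ => (n : ℝ) ^ ((p : ℝ) / (p + a : ℕ))) := by
  have hq : 0 < p + a := by omega
  choose r hr hr' using exists_nat_root hq
  have hsolve := copyLCL_solvedBy p a 6 c (fun n => r n + 1) hr'
  obtain ⟨t, ht⟩ := LCL.exists_hasTimeComplexity hsolve
  refine ⟨t, ht, ?_⟩
  have hpow : ∀ n : ℕ, ∃ y : ℝ, 0 ≤ y ∧ y ^ (p + a) = n ∧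
      (n : ℝ) ^ ((p : ℝ) / (p + a : ℕ)) = y ^ p := by
    intro n
    refine ⟨(n : ℝ) ^ (((p + a : ℕ) : ℝ)⁻¹), by positivity, ?_, ?_⟩
    · exact Real.rpow_inv_natCast_pow (by positivity) hq.ne'
    · rw [← Real.rpow_natCast, ← Real.rpow_mul (by positivity)]
      congr 1
      ring
  constructor
  · refine IsBigO.of_bound ((a + 4) * 2 ^ p) ?_
    filter_upwards [eventually_ge_atTop 1] with n hn
    obtain ⟨y, hy0, hy, hyp⟩ := hpow n
    rw [hyp, Real.norm_of_nonneg (by positivity), Real.norm_of_nonneg (by positivity)]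
    have hr1 : 1 ≤ r n := by
      by_contra hr0
      have := hr' n
      rw [show r n = 0 by omega, zero_add, one_pow] at this
      omega
    have hry : (r n : ℝ) ≤ y := by
      refine le_of_pow_le_pow_left₀ hq.ne' hy0 ?_
      rw [hy]
      exact_mod_cast hr n
    have h1 : t n ≤ 2 * (r n + 1) ^ p + a * (r n + 1) + 2 := ht.2 ⟨_, hsolve⟩ n
    have h2 : r n + 1 ≤ (r n + 1) ^ p := Nat.le_self_pow hp.ne' _
    have h3 : t n ≤ (a + 4) * (2 * r n) ^ p := by
      calc t n ≤ 2 * (r n + 1) ^ p + a * (r n + 1) ^ p + 2 * (r n + 1) ^ p := by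
            refine h1.trans ?_
            gcongr
            omega
        _ = (a + 4) * (r n + 1) ^ p := by ring
        _ ≤ _ := by gcongr; omega
    calc (t n : ℝ) ≤ (a + 4) * (2 * r n) ^ p := by exact_mod_cast h3
      _ ≤ (a + 4) * (2 * y) ^ p := by gcongr
      _ = _ := by rw [mul_pow]; ring
  · refine IsBigO.of_bound ((2 * (a + 1)) ^ p * 2) ?_
    filter_upwards [eventually_ge_atTop ((a + 1) * 2 ^ (p + a))] with n hn
    obtain ⟨y, hy0, hy, hyp⟩ := hpow n
    rw [hyp, Real.norm_of_nonneg (by positivity), Real.norm_of_nonneg (by positivity)]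
    obtain ⟨m, hm, hm'⟩ := exists_nat_root hq (n / (a + 1))
    have hm2 : 2 ≤ m := by
      by_contra hlt
      have h1 : 2 ^ (p + a) ≤ n / (a + 1) := by
        rw [Nat.le_div_iff_mul_le (by omega), mul_comm]
        exact hn
      have h2 := Nat.pow_le_pow_left (show m + 1 ≤ 2 by omega) (p + a)
      omega
    have hmn : m ^ p * ((a + 1) * m ^ a) ≤ n := by
      calc _ = m ^ (p + a) * (a + 1) := by ring
        _ ≤ n / (a + 1) * (a + 1) := by gcongr
        _ ≤ n := Nat.div_mul_le_self _ _
    obtain ⟨A, hA⟩ := ht.1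
    have h1 := pow_le_of_solvedBy hp (by omega) hc hmn hA
    have h2 : 2 ≤ m ^ p := hm2.trans (Nat.le_self_pow hp.ne' _)
    have hym : y ≤ 2 * (a + 1) * m := by
      refine le_of_pow_le_pow_left₀ hq.ne' (by positivity) ?_
      rw [hy]
      have h3 : n ≤ (a + 1) * (m + 1) ^ (p + a) := by
        rw [Nat.div_lt_iff_lt_mul (by omega)] at hm'
        rw [mul_comm]
        exact hm'.le
      have h4 : n ≤ (2 * (a + 1) * m) ^ (p + a) := by
        calc n ≤ (a + 1) * (m + 1) ^ (p + a) := h3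
          _ ≤ (a + 1) ^ (p + a) * (m + 1) ^ (p + a) := by
            gcongr
            exact Nat.le_self_pow hq.ne' _
          _ = ((a + 1) * (m + 1)) ^ (p + a) := by rw [mul_pow]
          _ ≤ ((a + 1) * (2 * m)) ^ (p + a) := by gcongr; omega
          _ = _ := by ring
      exact_mod_cast h4
    calc y ^ p ≤ (2 * (a + 1) * m) ^ p := by gcongr
      _ = (2 * (a + 1)) ^ p * (m : ℝ) ^ p := by rw [mul_pow]
      _ ≤ (2 * (a + 1)) ^ p * (2 * t n) := by
        gcongr
        exact_mod_cast (show m ^ p ≤ 2 * t n by omega)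
      _ = _ := by ring

theorem mainTheorem2 (α : ℚ) (hα0 : 0 ≤ α) (hα1 : α ≤ 1) :
    ∃ (Δ : ℕ) (P : LCL), ∀ c : ℕ, 1 ≤ c →
      ∃ t : ℕ → ℕ, P.HasTimeComplexity Δ c t ∧
        (fun n : ℕ => (t n : ℝ)) =Θ[atTop] (fun n : ℕ => (n : ℝ) ^ (α : ℝ)) := by
  rcases hα0.eq_or_lt with rfl | hpos
  · refine ⟨6, neighbourLCL, fun c hc => ?_⟩
    obtain ⟨t, ht⟩ := LCL.exists_hasTimeComplexity (neighbourLCL_solvedBy 6 c)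
    refine ⟨t, ht, ?_⟩
    obtain ⟨A, hA⟩ := ht.1
    have heq : (fun n : ℕ => (t n : ℝ)) =ᶠ[atTop] fun n : ℕ => (n : ℝ) ^ ((0 : ℚ) : ℝ) := by
      filter_upwards [eventually_ge_atTop 2] with n hn
      have h1 : t n ≤ 1 := ht.2 ⟨_, neighbourLCL_solvedBy 6 c⟩ n
      have h2 := one_le_of_neighbourLCL_solvedBy hc hn hA
      rw [le_antisymm h1 h2]
      simp
    exact heq.isTheta
  · have hnum : 0 < α.num := Rat.num_pos.2 hpos
    have hle : α.num ≤ α.den := by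
      have := Rat.le_iff α 1
      simpa using this.1 hα1
    obtain ⟨p, hp⟩ := Int.eq_ofNat_of_zero_le hnum.le
    obtain ⟨a, ha⟩ := Nat.exists_eq_add_of_le (show p ≤ α.den by omega)
    have hα : (α : ℝ) = (p : ℝ) / (p + a : ℕ) := by
      rw [Rat.cast_def, hp, ha]
      simp
    refine ⟨6, copyLCL p a, fun c hc => ?_⟩
    rw [hα]
    exact copyLCL_complexity a (by omega) hc
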